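/- For $\nu>0$ let $A^{(\nu)}(\mathbb D)$ be the Hilbert space of holomorphic functions on the open unit disc $\mathbb D$ with reproducing kernel $(1-z\bar w)^{-2\nu}$; the functions $\sqrt{(2\nu)_n/n!}\,z^n$, $n\ge 0$, form an orthonormal basis of it, where $(x)_n=x(x+1)\cdots(x+n-1)$. Let $m\ge 1$ be an integer, let $\lambda$ be real with $2\lambda-m>0$, let $\mu_0=1$ and $\mu_1,\dots,\mu_m>0$, and put $2\lambda_j=2\lambda-m+2j$ for $0\le j\le m$. For $f\in A^{(\lambda_j)}(\mathbb D)$ let $\Gamma_jf:\mathbb D\to\mathbb C^{m+1}$ be the function with components $$(\Gamma_jf)_\ell=\binom{\ell}{j}\frac{1}{(2\lambda_j)_{\ell-j}}f^{(\ell-j)}\ \text{ if } j\le\ell\le m,\qquad (\Gamma_jf)_\ell=0\ \text{ if } \ell<j .$$ Let $\mathbf A^{(\lambda,\mu)}(\mathbb D)$ be the Hilbert space of all functions $\sum_{j=0}^m\Gamma_jf_j$ with $f_j\in A^{(\lambda_j)}(\mathbb D)$ (the $f_j$ are determined by the sum), with the inner product $\big\langle\sum_j\Gamma_jf_j,\sum_j\Gamma_jg_j\big\rangle=\sum_j\mu_j^{-2}\langle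 f_j,g_j\rangle$. Put $e_n^j=\Gamma_j\big(\sqrt{(2\lambda_j)_n/n!}\,z^n\big)$, so that the vectors $\mu_je_n^j$ form an orthonormal basis of $\mathbf A^{(\lambda,\mu)}(\mathbb D)$, and let $H(n)$ be the linear span of the vectors $e^j_{n-j}$, $0\le j\le\min(m,n)$. **Theorem.** The operator $M$, $(MF)(z)=zF(z)$, is defined and bounded on the whole of $\mathbf A^{(\lambda,\mu)}(\mathbb D)$. It is a block shift: $\mathbf A^{(\lambda,\mu)}(\mathbb D)$ is the orthogonal direct sum of the spaces $H(n)$, $n\ge 0$, and $M H(n)\subseteq H(n+1)$. Its blocks, that is, the matrices $M(n)$ with $$M\mu_je^j_{n-j}=\sum_{0\le k\le\min(m,n+1)}M(n)_{k,j}\,\mu_ke^k_{n+1-k}\qquad(0\le j\le \min(m,n)),$$ which are of size $(m+1)\times(m+1)$ for $n\ge m$, satisfy $M(n)=I+O(1/n)$ entrywise as $n\to\infty$. There is a bounded operator $U_+$ on $\mathbf A^{(\lambda,\mu)}(\mathbb D)$ with $U_+e^j_n=e^j_{n+1}$ for all $0\le j\le m$, $n\ge0$, and $M-U_+$ is a Hilbert–Schmidt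 operator. The adjoint $T=M^*$ belongs to the Cowen–Douglas class $B_{m+1}(\mathbb D)$: for every $w\in\mathbb D$, $w$ is in the spectrum of $T$, $T-w$ is surjective and $\dim\ker(T-w)=m+1$; and the subspaces $\ker(T-w)$, $w\in\mathbb D$, span a dense subspace. -/

import Mathlib

open scoped ComplexConjugate Topology
open Complex.UnitDisc Filter

noncomputable section

namespace HomogShift

/-- The Pochhammer symbol `(x)_n = x (x + 1) ⋯ (x + n - 1)`. -/
def poch (x : ℝ) (n : ℕ) : ℝ := (ascPochhammer ℝ n).eval x

lemma poch_pos {x : ℝ} (hx : 0 < x) (n : ℕ) : 0 < poch x n := ascPochhammer_pos n x hx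

/-- The coefficient `√((2ν)_n / n!)`. -/
def coef (ν : ℝ) (n : ℕ) : ℝ := Real.sqrt (poch (2 * ν) n / n.factorial)

lemma coef_pos {ν : ℝ} (hν : 0 < ν) (n : ℕ) : 0 < coef ν n :=
  Real.sqrt_pos.2 (div_pos (poch_pos (by positivity) n) (by positivity))

lemma coef_sq {ν : ℝ} (hν : 0 < ν) (n : ℕ) : coef ν n ^ 2 = Ring.choose (2 * ν + n - 1) n := by
  have h := Ring.factorial_nsmul_multichoose_eq_ascPochhammer (2 * ν) n
  rw [Polynomial.ascPochhammer_smeval_eq_eval, nsmul_eq_mul, Ring.multichoose_eq] at h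
  rw [coef, Real.sq_sqrt (div_pos (poch_pos (by positivity) n) (by positivity)).le, poch, ← h]
  field_simp

lemma hasSum_coef_sq {ν : ℝ} (hν : 0 < ν) {z : ℂ} (hz : ‖z‖ < 1) :
    HasSum (fun n : ℕ => ((coef ν n : ℂ)) ^ 2 * z ^ n) ((1 - z) ^ (-(2 * ν : ℂ))) := by
  have h := (Complex.one_div_one_sub_cpow_hasFPowerSeriesOnBall_zero (2 * ν : ℂ)).hasSum
    (y := z) (by simpa [enorm_eq_nnnorm, ← NNReal.coe_lt_one] using hz)
  rw [Complex.cpow_neg]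
  simp only [zero_add, one_div, FormalMultilinearSeries.ofScalars_apply_eq, smul_eq_mul] at h
  convert! h using 2 with n
  congr 1
  have := coef_sq hν n
  rw [← Complex.ofReal_pow, this, Complex.ofReal_choose]
  push_cast; rfl

lemma summable_coef_sq {ν : ℝ} (hν : 0 < ν) {r : ℝ} (h0 : 0 ≤ r) (hr : r < 1) :
    Summable (fun n : ℕ => (coef ν n) ^ 2 * r ^ n) := by
  have h := (hasSum_coef_sq hν (z := (r : ℂ)) (by simpa [abs_of_nonneg h0] using hr)).summable
  exact_mod_cast h

/-- The space `A^(ν)(𝔻)`, `ν > 0`: the Hilbert space of the functions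
`z ↦ ∑ a_n √((2ν)_n / n!) z^n` with square summable coefficients `a`, in which the functions
`√((2ν)_n / n!) z^n` form an orthonormal basis.  It is the Hilbert space of holomorphic functions
on the disc with reproducing kernel `(1 - z w̄)^(-2ν)`, see `kernel_discSpace`. -/
def DiscSpace (_ν : {x : ℝ // 0 < x}) : Type := lp (fun _ : ℕ => ℂ) 2

variable {ν : {x : ℝ // 0 < x}}

instance : NormedAddCommGroup (DiscSpace ν) :=
  inferInstanceAs (NormedAddCommGroup (lp (fun _ : ℕ => ℂ) 2))
instance : InnerProductSpace ℂ (DiscSpace ν) :=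
  inferInstanceAs (InnerProductSpace ℂ (lp (fun _ : ℕ => ℂ) 2))
instance : CompleteSpace (DiscSpace ν) :=
  inferInstanceAs (CompleteSpace (lp (fun _ : ℕ => ℂ) 2))

/-- The coefficients of an element with respect to the orthonormal basis `√((2ν)_n / n!) z^n`. -/
def DiscSpace.coeff (f : DiscSpace ν) (n : ℕ) : ℂ := (show lp (fun _ : ℕ => ℂ) 2 from f) n

/-- The kernel vector at `z`, used to see that the evaluation at `z` is continuous. -/
def kerVec (ν : {x : ℝ // 0 < x}) (z : 𝔻) : DiscSpace ν :=
  (⟨fun n => (coef ν n : ℂ) * conj (z : ℂ) ^ n, by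
    refine memℓp_gen ?_
    have h := summable_coef_sq ν.2 (sq_nonneg ‖(z : ℂ)‖) z.sq_norm_lt_one
    refine h.congr fun n => ?_
    rw [ENNReal.toReal_ofNat, Real.rpow_two, norm_mul, norm_pow, RCLike.norm_conj,
      Complex.norm_real, Real.norm_eq_abs, mul_pow, sq_abs, ← pow_mul, ← pow_mul,
      mul_comm n 2]⟩ : lp (fun _ : ℕ => ℂ) 2)

lemma hasSum_inner_kerVec (f : DiscSpace ν) (z : 𝔻) :
    HasSum (fun n => f.coeff n * (coef ν n * (z : ℂ) ^ n)) (inner ℂ (kerVec ν z) f) := by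
  have h := lp.hasSum_inner (𝕜 := ℂ) (G := fun _ : ℕ => ℂ)
    (show lp (fun _ : ℕ => ℂ) 2 from kerVec ν z) (show lp (fun _ : ℕ => ℂ) 2 from f)
  convert! h using 2 with n
  simp [DiscSpace.coeff, kerVec, RCLike.inner_apply]

lemma coeff_add (f g : DiscSpace ν) (n : ℕ) : (f + g).coeff n = f.coeff n + g.coeff n := rfl
lemma coeff_smul (c : ℂ) (f : DiscSpace ν) (n : ℕ) : (c • f).coeff n = c * f.coeff n := rfl

lemma coeff_ext {f g : DiscSpace ν} (h : ∀ n, f.coeff n = g.coeff n) : f = g :=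
  lp.ext (funext h)

/-- The extension of a function on the disc to the plane by zero. -/
def ext0 (f : 𝔻 → ℂ) (z : ℂ) : ℂ := if h : ‖z‖ < 1 then f (.mk z h) else 0

lemma ext0_coe (f : 𝔻 → ℂ) (z : 𝔻) : ext0 f z = f z := by
  simp only [ext0, z.norm_lt_one, dite_true]
  rfl

lemma hasFPowerSeries_aux (f : DiscSpace ν) :
    HasFPowerSeriesOnBall (ext0 fun z => ∑' n, f.coeff n * (coef ν n * (z : ℂ) ^ n))
      (.ofScalars ℂ fun n => f.coeff n * coef ν n) 0 1 where
  r_le := by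
    refine ENNReal.le_of_forall_nnreal_lt fun r hr => ?_
    have hr' : ‖((r : ℝ) : ℂ)‖ < 1 := by simpa using hr
    have h := (hasSum_inner_kerVec f (.mk _ hr')).summable.norm
    refine FormalMultilinearSeries.le_radius_of_summable_norm _ (h.congr fun n => ?_)
    simp [mul_assoc]
  r_pos := one_pos
  hasSum := by
    intro y hy
    have hy' : ‖y‖ < 1 := by simpa [enorm_eq_nnnorm, ← NNReal.coe_lt_one] using hy
    have h := (hasSum_inner_kerVec f (.mk y hy')).summable.hasSum
    simp only [zero_add, ext0, hy', dite_true]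
    convert! h using 2 with n
    simp only [FormalMultilinearSeries.ofScalars_apply_eq, smul_eq_mul, Complex.UnitDisc.coe_mk]
    ring

instance : RKHS ℂ (DiscSpace ν) 𝔻 ℂ where
  coeCLM :=
    { toFun := fun f z => ∑' n, f.coeff n * (coef ν n * (z : ℂ) ^ n)
      map_add' := fun f g => by
        funext z
        simp only [(hasSum_inner_kerVec _ z).tsum_eq, inner_add_right, Pi.add_apply]
      map_smul' := fun c f => by
        funext z
        simp only [(hasSum_inner_kerVec _ z).tsum_eq, inner_smul_right, Pi.smul_apply,
          RingHom.id_apply, smul_eq_mul]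
      cont := by
        refine continuous_pi fun z => ?_
        simp only [(hasSum_inner_kerVec _ z).tsum_eq]
        fun_prop }
  coeCLM_injective := by
    intro f g h
    have h' : (fun z : 𝔻 => ∑' n, f.coeff n * (coef ν n * (z : ℂ) ^ n)) =
      fun z : 𝔻 => ∑' n, g.coeff n * (coef ν n * (z : ℂ) ^ n) := h
    have hf := (hasFPowerSeries_aux f).hasFPowerSeriesAt
    rw [h'] at hf
    have := hf.eq_formalMultilinearSeries (hasFPowerSeries_aux g).hasFPowerSeriesAt
    rw [FormalMultilinearSeries.ofScalars_series_eq_iff] at this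
    refine coeff_ext fun n => ?_
    have hn := congrFun this n
    exact mul_right_cancel₀ (by exact_mod_cast (coef_pos ν.2 n).ne') hn

lemma discSpace_apply (f : DiscSpace ν) (z : 𝔻) :
    f z = ∑' n, f.coeff n * (coef ν n * (z : ℂ) ^ n) := rfl

lemma discSpace_apply_eq_inner (f : DiscSpace ν) (z : 𝔻) : f z = inner ℂ (kerVec ν z) f :=
  (hasSum_inner_kerVec f z).tsum_eq

lemma hasFPowerSeries_discSpace (f : DiscSpace ν) :
    HasFPowerSeriesOnBall (ext0 f) (.ofScalars ℂ fun n => f.coeff n * coef ν n) 0 1 :=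
  hasFPowerSeries_aux f

/-- The reproducing kernel of `A^(ν)(𝔻)` is `(1 - z w̄)^(-2ν)`. -/
theorem kernel_discSpace (z w : 𝔻) (v : ℂ) :
    RKHS.kernel (DiscSpace ν) z w v = (1 - (z : ℂ) * conj (w : ℂ)) ^ (-(2 * (ν : ℝ) : ℂ)) * v := by
  have hk : RKHS.kerFun (DiscSpace ν) w v = v • kerVec ν w := by
    refine ext_inner_right ℂ fun f => ?_
    rw [RKHS.kerFun_inner, discSpace_apply_eq_inner, inner_smul_left, RCLike.inner_apply, mul_comm]
  rw [← RKHS.kerFun_apply, hk, RKHS.coe_smul, Pi.smul_apply, discSpace_apply, smul_eq_mul,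
    mul_comm]
  congr 1
  have hz : ‖(z : ℂ) * conj (w : ℂ)‖ < 1 := by
    rw [norm_mul, RCLike.norm_conj]
    exact mul_lt_one_of_nonneg_of_lt_one_left (norm_nonneg _) z.norm_lt_one w.norm_lt_one.le
  rw [← (hasSum_coef_sq ν.2 hz).tsum_eq]
  refine tsum_congr fun n => ?_
  simp only [DiscSpace.coeff, kerVec]
  ring

/-- Every element of `A^(ν)(𝔻)` is holomorphic on the disc. -/
lemma analyticAt_discSpace (f : DiscSpace ν) (z : 𝔻) : AnalyticAt ℂ (ext0 f) z :=
  (hasFPowerSeries_discSpace f).analyticAt_of_mem (by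
    simpa [enorm_eq_nnnorm, ← NNReal.coe_lt_one] using z.norm_lt_one)

/-- The monomial `z^n` as an element of `A^(ν)(𝔻)`. -/
def monomial (ν : {x : ℝ // 0 < x}) (n : ℕ) : DiscSpace ν :=
  (lp.single 2 n (((coef ν n)⁻¹ : ℝ) : ℂ) : lp (fun _ : ℕ => ℂ) 2)

lemma monomial_apply (n : ℕ) (z : 𝔻) : monomial ν n z = (z : ℂ) ^ n := by
  rw [discSpace_apply, tsum_eq_single n]
  · have : (coef ν n : ℂ) ≠ 0 := by exact_mod_cast (coef_pos ν.2 n).ne'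
    simp [DiscSpace.coeff, monomial, this]
  · intro k hk
    have h0 : (monomial ν n).coeff k = 0 := lp.single_apply_ne 2 n _ hk
    rw [h0, zero_mul]

/-- The `k`-th derivative `f^(k)(z)` of `f ∈ A^(ν)(𝔻)`. -/
def derivDisc (k : ℕ) (f : DiscSpace ν) (z : 𝔻) : ℂ := iteratedDeriv k (ext0 f) z

lemma ext0_add (f g : 𝔻 → ℂ) : ext0 (f + g) = ext0 f + ext0 g := by
  funext z; by_cases h : ‖z‖ < 1 <;> simp [ext0, h]

lemma ext0_smul (c : ℂ) (f : 𝔻 → ℂ) : ext0 (c • f) = c • ext0 f := by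
  funext z; by_cases h : ‖z‖ < 1 <;> simp [ext0, h]

lemma derivDisc_zero (f : DiscSpace ν) (z : 𝔻) : derivDisc 0 f z = f z := by
  simp [derivDisc, ext0_coe]

lemma derivDisc_add (k : ℕ) (f g : DiscSpace ν) (z : 𝔻) :
    derivDisc k (f + g) z = derivDisc k f z + derivDisc k g z := by
  rw [derivDisc, RKHS.coe_add, ext0_add]
  exact iteratedDeriv_add (analyticAt_discSpace f z).contDiffAt
    (analyticAt_discSpace g z).contDiffAt

lemma derivDisc_smul (k : ℕ) (c : ℂ) (f : DiscSpace ν) (z : 𝔻) :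
    derivDisc k (c • f) z = c * derivDisc k f z := by
  rw [derivDisc, RKHS.coe_smul, ext0_smul, iteratedDeriv_const_smul_field]
  rfl

lemma continuous_derivDisc (k : ℕ) (z : 𝔻) :
    Continuous fun f : DiscSpace ν => derivDisc k f z := by
  induction k generalizing z with
  | zero => simpa only [derivDisc_zero] using RKHS.continuous_eval z
  | succ k ih =>
    -- a sequence of points of the disc converging to `z`
    have hlim : ∀ f : DiscSpace ν, Tendsto
        (fun h : ℂ => h⁻¹ • (iteratedDeriv k (ext0 f) (z + h) - iteratedDeriv k (ext0 f) z))
        (𝓝[≠] 0) (𝓝 (derivDisc (k + 1) f z)) := by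
      intro f
      have hd : HasDerivAt (iteratedDeriv k (ext0 f)) (derivDisc (k + 1) f z) z := by
        rw [derivDisc, iteratedDeriv_succ]
        have ha : AnalyticAt ℂ (iteratedDeriv k (ext0 f)) z := by
          rw [iteratedDeriv_eq_iterate]
          exact (analyticAt_discSpace f z).iterated_deriv k
        exact ha.differentiableAt.hasDerivAt
      exact hasDerivAt_iff_tendsto_slope_zero.1 hd
    obtain ⟨u, hu⟩ := exists_seq_tendsto (𝓝[≠] (0 : ℂ))
    have hin : ∀ᶠ n in atTop, ‖(z : ℂ) + u n‖ < 1 := by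
      have h1 : Tendsto (fun n => ‖(z : ℂ) + u n‖) atTop (𝓝 ‖(z : ℂ) + 0‖) :=
        (tendsto_const_nhds.add (hu.mono_right nhdsWithin_le_nhds)).norm
      exact h1.eventually_lt_const (by simpa using z.norm_lt_one)
    obtain ⟨N, hN⟩ := eventually_atTop.1 hin
    let w : ℕ → 𝔻 := fun n => .mk ((z : ℂ) + u (n + N)) (hN _ (Nat.le_add_left _ _))
    let D : 𝔻 → (DiscSpace ν →L[ℂ] ℂ) := fun x =>
      { toFun := fun f => derivDisc k f x
        map_add' := fun f g => derivDisc_add k f g x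
        map_smul' := fun c f => derivDisc_smul k c f x
        cont := ih x }
    let g : ℕ → (DiscSpace ν →L[ℂ] ℂ) := fun n => (u (n + N))⁻¹ • (D (w n) - D z)
    have hg : Tendsto (fun n f => g n f) atTop (𝓝 fun f => derivDisc (k + 1) f z) := by
      rw [tendsto_pi_nhds]
      intro f
      exact ((hlim f).comp hu).comp (tendsto_add_atTop_nat N)
    exact (continuousLinearMapOfTendsto g hg).continuous

/-- The parameters: `2λ - m > 0`, and positive numbers `μ_0 = 1, μ_1, …, μ_m`. -/
structure Params (m : ℕ) where
  lam : ℝ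
  mu : Fin (m + 1) → ℝ
  lam_gt : 0 < 2 * lam - m
  mu_pos : ∀ j, 0 < mu j
  mu_zero : mu 0 = 1

variable {m : ℕ}

/-- `λ_j`, defined by `2λ_j = 2λ - m + 2j`. -/
def Params.lamj (p : Params m) (j : Fin (m + 1)) : {x : ℝ // 0 < x} :=
  ⟨(2 * p.lam - m + 2 * (j : ℕ)) / 2, by
    have h1 := p.lam_gt
    have h2 : (0 : ℝ) ≤ ((j : ℕ) : ℝ) := Nat.cast_nonneg _
    linarith⟩

/-- The operator `Γ_j` from `A^(λ_j)(𝔻)` to the functions on the disc with values in `ℂ^(m+1)`: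
`(Γ_j f)_ℓ = binom(ℓ, j) / (2λ_j)_(ℓ-j) · f^(ℓ-j)` if `ℓ ≥ j`, and `0` if `ℓ < j`. -/
def Gam (p : Params m) (j : Fin (m + 1)) (f : DiscSpace (p.lamj j)) (z : 𝔻) :
    EuclideanSpace ℂ (Fin (m + 1)) :=
  WithLp.toLp 2 fun l => if j ≤ l then
    (((l : ℕ).choose j / poch (2 * p.lamj j) (l - j) : ℝ) : ℂ) * derivDisc (l - j) f z else 0

lemma Gam_add (p : Params m) (j : Fin (m + 1)) (f g : DiscSpace (p.lamj j)) (z : 𝔻) :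
    Gam p j (f + g) z = Gam p j f z + Gam p j g z := by
  ext l
  by_cases h : j ≤ l <;> simp [Gam, h, derivDisc_add, mul_add]

lemma Gam_smul (p : Params m) (j : Fin (m + 1)) (c : ℂ) (f : DiscSpace (p.lamj j)) (z : 𝔻) :
    Gam p j (c • f) z = c • Gam p j f z := by
  ext l
  by_cases h : j ≤ l
  · simp [Gam, h, derivDisc_smul]; ring
  · simp [Gam, h]

lemma Gam_zero (p : Params m) (j : Fin (m + 1)) (z : 𝔻) : Gam p j 0 z = 0 := by
  simpa using Gam_smul p j 0 0 z

lemma continuous_Gam (p : Params m) (j : Fin (m + 1)) (z : 𝔻) :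
    Continuous fun f => Gam p j f z := by
  refine (PiLp.continuous_toLp 2 _).comp (continuous_pi fun l => ?_)
  by_cases h : j ≤ l
  · simp only [h, if_true]
    exact continuous_const.mul (continuous_derivDisc _ z)
  · simpa only [h, if_false] using continuous_const

/-- The Hilbert space `A^(λ,μ)(𝔻)`: the orthogonal direct sum of the spaces `A^(λ_j)(𝔻)`,
`0 ≤ j ≤ m`, transferred to a space of `ℂ^(m+1)`-valued functions on the disc by the injective map
`Γ = ∑_j μ_j Γ_j`.  So `(f_j)_j` is the function `∑_j μ_j Γ_j f_j`, and the inner product of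
`∑_j Γ_j f_j` and `∑_j Γ_j g_j` is `∑_j μ_j^(-2) ⟪f_j, g_j⟫`, see `inner_sum_embed`. -/
def VecSpace (p : Params m) : Type := PiLp 2 fun j => DiscSpace (p.lamj j)

variable {p : Params m}

instance : NormedAddCommGroup (VecSpace p) :=
  inferInstanceAs (NormedAddCommGroup (PiLp 2 fun j => DiscSpace (p.lamj j)))
instance : InnerProductSpace ℂ (VecSpace p) :=
  inferInstanceAs (InnerProductSpace ℂ (PiLp 2 fun j => DiscSpace (p.lamj j)))
instance : CompleteSpace (VecSpace p) :=
  inferInstanceAs (CompleteSpace (PiLp 2 fun j => DiscSpace (p.lamj j)))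

/-- The component in `A^(λ_j)(𝔻)`. -/
def VecSpace.comp (F : VecSpace p) (j : Fin (m + 1)) : DiscSpace (p.lamj j) :=
  (show PiLp 2 fun j => DiscSpace (p.lamj j) from F) j

lemma comp_add (F G : VecSpace p) (j : Fin (m + 1)) : (F + G).comp j = F.comp j + G.comp j := rfl
lemma comp_smul (c : ℂ) (F : VecSpace p) (j : Fin (m + 1)) : (c • F).comp j = c • F.comp j := rfl
lemma continuous_comp (j : Fin (m + 1)) : Continuous fun F : VecSpace p => F.comp j :=
  PiLp.continuous_apply 2 _ j

instance : RKHS ℂ (VecSpace p) 𝔻 (EuclideanSpace ℂ (Fin (m + 1))) where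
  coeCLM :=
    { toFun := fun F z => ∑ j, (p.mu j : ℂ) • Gam p j (F.comp j) z
      map_add' := fun F G => by
        funext z
        simp only [comp_add, Gam_add, smul_add, Finset.sum_add_distrib, Pi.add_apply]
      map_smul' := fun c F => by
        funext z
        simp only [comp_smul, Gam_smul, Finset.smul_sum, Pi.smul_apply, RingHom.id_apply,
          smul_comm c]
      cont := continuous_pi fun z => continuous_finsetSum _ fun j _ =>
        ((continuous_const_smul (p.mu j : ℂ)).comp (continuous_Gam p j z)).comp
          (continuous_comp j) }
  coeCLM_injective := by
    refine (injective_iff_map_eq_zero _).2 fun F hF => ?_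
    have hF' : ∀ z : 𝔻, ∑ j, (p.mu j : ℂ) • Gam p j (F.comp j) z = 0 := fun z => congrFun hF z
    have key : ∀ (k : ℕ) (j : Fin (m + 1)), (j : ℕ) = k → F.comp j = 0 := by
      intro k
      induction k using Nat.strong_induction_on with
      | _ k ih =>
        intro j hj
        refine RKHS.ext fun z => ?_
        have h := congrArg (fun v : EuclideanSpace ℂ (Fin (m + 1)) => v j) (hF' z)
        simp only [WithLp.ofLp_sum, Finset.sum_apply] at h
        rw [Finset.sum_eq_single j] at h
        · have h1 : (p.mu j : ℂ) ≠ 0 := by exact_mod_cast (p.mu_pos j).ne'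
          simpa [Gam, poch, h1, derivDisc_zero] using h
        · intro i _ hij
          rcases lt_or_gt_of_ne hij with hlt | hgt
          · rw [ih i (by rw [← hj]; exact hlt) i rfl, Gam_zero]; simp
          · have : ¬ i ≤ j := not_le.2 hgt
            simp [Gam, this]
        · simp
    exact PiLp.ext fun j => key j j rfl

lemma vecSpace_apply (F : VecSpace p) (z : 𝔻) :
    F z = ∑ j, (p.mu j : ℂ) • Gam p j (F.comp j) z := rfl

/-- The function `Γ_j f` as an element of `A^(λ,μ)(𝔻)`. -/
def embed (p : Params m) (j : Fin (m + 1)) (f : DiscSpace (p.lamj j)) : VecSpace p :=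
  (PiLp.single 2 j (((p.mu j : ℂ)⁻¹) • f) : PiLp 2 fun j => DiscSpace (p.lamj j))

lemma embed_comp_self (j : Fin (m + 1)) (f : DiscSpace (p.lamj j)) :
    (embed p j f).comp j = (p.mu j : ℂ)⁻¹ • f := PiLp.single_eq_same _ _ _

lemma embed_comp_ne {i j : Fin (m + 1)} (h : i ≠ j) (f : DiscSpace (p.lamj j)) :
    (embed p j f).comp i = 0 := PiLp.single_eq_of_ne _ h _

lemma embed_apply (j : Fin (m + 1)) (f : DiscSpace (p.lamj j)) (z : 𝔻) :
    embed p j f z = Gam p j f z := by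
  rw [vecSpace_apply, Finset.sum_eq_single j]
  · have h1 : (p.mu j : ℂ) ≠ 0 := by exact_mod_cast (p.mu_pos j).ne'
    rw [embed_comp_self, Gam_smul, smul_smul, mul_inv_cancel₀ h1, one_smul]
  · intro i _ hij
    rw [embed_comp_ne hij, Gam_zero, smul_zero]
  · simp

/-- Every element of `A^(λ,μ)(𝔻)` is a sum `∑_j Γ_j f_j`. -/
lemma eq_sum_embed (F : VecSpace p) : F = ∑ j, embed p j ((p.mu j : ℂ) • F.comp j) := by
  have hs : ∀ (s : Finset (Fin (m + 1))) (G : Fin (m + 1) → VecSpace p) (z : 𝔻),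
      (∑ j ∈ s, G j) z = ∑ j ∈ s, G j z := fun s G z => by
    classical
    induction s using Finset.induction_on with
    | empty => simp
    | insert a s ha ih => simp [Finset.sum_insert ha, ih]
  refine RKHS.ext fun z => ?_
  rw [hs, vecSpace_apply]
  exact Finset.sum_congr rfl fun j _ => by rw [embed_apply, Gam_smul]

/-- The inner product of `A^(λ,μ)(𝔻)`. -/
lemma inner_sum_embed (f g : ∀ j, DiscSpace (p.lamj j)) :
    inner ℂ (∑ j, embed p j (f j)) (∑ j, embed p j (g j)) =
      ∑ j, ((p.mu j : ℂ) ^ 2)⁻¹ * inner ℂ (f j) (g j) := by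
  have hc : ∀ (f : ∀ j, DiscSpace (p.lamj j)) (i : Fin (m + 1)),
      (∑ j, embed p j (f j)).comp i = (p.mu i : ℂ)⁻¹ • f i := by
    intro f i
    let φ : VecSpace p →+ DiscSpace (p.lamj i) :=
      AddMonoidHom.mk' (fun F => F.comp i) fun F G => comp_add F G i
    change φ (∑ j, embed p j (f j)) = _
    rw [map_sum, Finset.sum_eq_single i]
    · exact embed_comp_self i (f i)
    · exact fun j _ hj => embed_comp_ne hj.symm (f j)
    · simp
  have h : ∀ F G : VecSpace p, inner ℂ F G = ∑ j, inner ℂ (F.comp j) (G.comp j) :=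
    fun F G => PiLp.inner_apply (𝕜 := ℂ) _ _
  rw [h]
  refine Finset.sum_congr rfl fun j _ => ?_
  rw [hc, hc, inner_smul_left, inner_smul_right, map_inv₀, Complex.conj_ofReal, ← mul_assoc,
    ← mul_inv, sq]

/-- The vector `e_n^j = Γ_j (√((2λ_j)_n / n!) z^n)` of `A^(λ,μ)(𝔻)`. -/
def e (p : Params m) (j : Fin (m + 1)) (n : ℕ) : VecSpace p :=
  embed p j ((coef (p.lamj j) n : ℂ) • monomial (p.lamj j) n)

/-- The vectors `μ_j e_n^j` are orthonormal in `A^(λ,μ)(𝔻)`. -/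
lemma orthonormal_mu_e (p : Params m) :
    Orthonormal ℂ fun a : Fin (m + 1) × ℕ => (p.mu a.1 : ℂ) • e p a.1 a.2 := by
  have hcomp : ∀ (j : Fin (m + 1)) (n : ℕ), ((p.mu j : ℂ) • e p j n).comp j =
      (lp.single 2 n (1 : ℂ) : lp (fun _ : ℕ => ℂ) 2) := by
    intro j n
    have h1 : (p.mu j : ℂ) ≠ 0 := by exact_mod_cast (p.mu_pos j).ne'
    have h2 : (coef (p.lamj j) n : ℂ) ≠ 0 := by exact_mod_cast (coef_pos (p.lamj j).2 n).ne'
    rw [comp_smul, e, embed_comp_self, smul_smul, mul_inv_cancel₀ h1, one_smul]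
    refine (lp.single_smul 2 n _ _).symm.trans ?_
    rw [smul_eq_mul, Complex.ofReal_inv, mul_inv_cancel₀ h2]
  have hne : ∀ (i j : Fin (m + 1)) (n : ℕ), i ≠ j → ((p.mu j : ℂ) • e p j n).comp i = 0 := by
    intro i j n h
    rw [comp_smul, e, embed_comp_ne h, smul_zero]
  have hin : ∀ F G : VecSpace p, inner ℂ F G = ∑ j, inner ℂ (F.comp j) (G.comp j) :=
    fun F G => PiLp.inner_apply (𝕜 := ℂ) _ _
  rw [orthonormal_iff_ite]
  rintro ⟨i, k⟩ ⟨j, n⟩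
  rw [hin, Finset.sum_eq_single j]
  · by_cases hij : i = j
    · subst hij
      rw [hcomp, hcomp]
      refine (lp.inner_single_left (𝕜 := ℂ) (G := fun _ : ℕ => ℂ) k 1 _).trans ?_
      by_cases hkn : k = n
      · subst hkn; simp
      · simp [hkn]
    · rw [hne j i k (Ne.symm hij), inner_zero_left]
      simp [hij]
  · intro l _ hl
    rw [hne l j n hl, inner_zero_right]
  · simp

/-- The space `H(n)`: the linear span of the vectors `e_{n-j}^j`, `0 ≤ j ≤ min(m, n)`. -/
def blockSpace (p : Params m) (n : ℕ) : Submodule ℂ (VecSpace p) :=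
  Submodule.span ℂ {v | ∃ j : Fin (m + 1), (j : ℕ) ≤ n ∧ v = e p j (n - j)}

section Operators

variable {H : Type*} [NormedAddCommGroup H] [InnerProductSpace ℂ H] [CompleteSpace H]

/-- `T` is a block shift with respect to the subspaces `V_n`, `n ≥ 0`: the Hilbert space is the
orthogonal direct sum of the `V_n`, and `T V_n ⊆ V_{n+1}`. -/
def IsBlockShift (T : H →L[ℂ] H) (V : ℕ → Submodule ℂ H) : Prop :=
  IsHilbertSum ℂ (fun n => V n) (fun n => (V n).subtypeₗᵢ) ∧ ∀ n, ∀ v ∈ V n, T v ∈ V (n + 1)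

/-- `T` is a Hilbert-Schmidt operator: `∑ ‖T b_i‖² < ∞` for some orthonormal basis `b` (then for
every one). -/
def IsHilbertSchmidt {H : Type} [NormedAddCommGroup H] [InnerProductSpace ℂ H] [CompleteSpace H]
    (T : H →L[ℂ] H) : Prop :=
  ∃ (ι : Type) (b : HilbertBasis ι ℂ H), Summable fun i => ‖T (b i)‖ ^ 2

/-- `T` belongs to the Cowen-Douglas class `B_n(Ω)` (`Ω ⊆ ℂ` open and connected, `n ≥ 1`). -/
structure IsCowenDouglas (T : H →L[ℂ] H) (Ω : Set ℂ) (n : ℕ) : Prop where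
  subset_spectrum : Ω ⊆ spectrum ℂ T
  surjective : ∀ w ∈ Ω, Function.Surjective (T - w • ContinuousLinearMap.id ℂ H)
  dense : (⨆ w ∈ Ω, (T - w • ContinuousLinearMap.id ℂ H).ker).topologicalClosure = ⊤
  finite : ∀ w ∈ Ω, FiniteDimensional ℂ (T - w • ContinuousLinearMap.id ℂ H).ker
  finrank : ∀ w ∈ Ω, Module.finrank ℂ (T - w • ContinuousLinearMap.id ℂ H).ker = n

end Operators

end HomogShift

end

/-!
On `Γ_j f`, multiplication by `z` acts as `z Γ_j f = Γ_j (z f) - ∑_{k > j} c_{j,k} Γ_k f^(k-j-1)`;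
comparing components, the `c_{j,k}` are determined by a sum that telescopes. In the orthonormal
basis `μ_j e_n^j` this says that `M` is the block unilateral shift `U_+` plus weights of size
`O(1/n)`, so `M - U_+` is Hilbert-Schmidt, in particular compact.

For `a ∈ 𝔻` the operator `U_+ - a` is bounded below because `U_+` is an isometry. A compact
perturbation of an operator bounded below is bounded below as soon as it is injective, and `M - a`
is injective because the functions are continuous; hence its adjoint is surjective. The
eigenspaces of `M^*` consist of kernel functions: kernel functions are eigenvectors, and an
eigenvector orthogonal to the constants vanishes, as the constants are cyclic for `M`.
-/

noncomputable section

namespace HomogShift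

section CompactPerturbation

variable {𝕜 E F : Type*} [RCLike 𝕜] [NormedAddCommGroup E] [NormedSpace 𝕜 E] [CompleteSpace E]
  [NormedAddCommGroup F] [NormedSpace 𝕜 F]

lemma exists_tendsto_subseq_of_tendsto_add_isCompactOperator {A K : E →L[𝕜] F} {c : NNReal}
    (hA : AntilipschitzWith c A) (hK : IsCompactOperator K) {x : ℕ → E} {r : ℝ}
    (hx : ∀ n, ‖x n‖ ≤ r) {y : F} (hxy : Tendsto (fun n => (A + K) (x n)) atTop (𝓝 y)) :
    ∃ x₀, ∃ φ : ℕ → ℕ, StrictMono φ ∧ Tendsto (x ∘ φ) atTop (𝓝 x₀) := by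
  obtain ⟨s, hs, hKs⟩ := hK.image_closedBall_subset_compact r
  obtain ⟨y', -, φ, hφ, hKx⟩ := hs.tendsto_subseq (x := fun n => K (x n))
    fun n => hKs ⟨x n, by simpa using hx n, rfl⟩
  have hAx : Tendsto (fun n => A (x (φ n))) atTop (𝓝 (y - y')) := by
    simpa [Function.comp_def] using (hxy.comp hφ.tendsto_atTop).sub hKx
  have hcauchy : CauchySeq (x ∘ φ) := by
    rw [CauchySeq, ← (hA.isUniformInducing A.uniformContinuous).cauchy_map_iff, map_map]
    exact hAx.cauchySeq
  obtain ⟨x₀, hx₀⟩ := cauchySeq_tendsto_of_complete hcauchy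
  exact ⟨x₀, φ, hφ, hx₀⟩

theorem exists_antilipschitzWith_add_isCompactOperator {A K : E →L[𝕜] F} {c : NNReal}
    (hA : AntilipschitzWith c A) (hK : IsCompactOperator K)
    (hinj : Function.Injective (A + K)) : ∃ c', AntilipschitzWith c' (A + K) := by
  rw [antilipschitzWith_iff_exists_mul_le_norm]
  by_contra! hnot
  have hunit : ∀ n : ℕ, ∃ x : E, ‖x‖ = 1 ∧ ‖(A + K) x‖ < 1 / ((n : ℝ) + 1) := by
    intro n
    obtain ⟨x, hx⟩ := hnot (1 / ((n : ℝ) + 1)) (by positivity)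
    have hx₀ : x ≠ 0 := by rintro rfl; simp at hx
    refine ⟨((‖x‖⁻¹ : ℝ) : 𝕜) • x, by simp [norm_smul, hx₀], ?_⟩
    rwa [map_smul, norm_smul, RCLike.norm_ofReal, abs_inv, abs_norm,
      inv_mul_lt_iff₀ (norm_pos_iff.2 hx₀), mul_comm]
  choose x hx hAKx using hunit
  have hlim : Tendsto (fun n => (A + K) (x n)) atTop (𝓝 0) :=
    squeeze_zero_norm (fun n => (hAKx n).le) tendsto_one_div_add_atTop_nhds_zero_nat
  obtain ⟨x₀, φ, hφ, hx₀⟩ := exists_tendsto_subseq_of_tendsto_add_isCompactOperator hA hK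
    (fun n => (hx n).le) hlim
  have hzero : (A + K) x₀ = 0 := tendsto_nhds_unique
    (((A + K).continuous.tendsto x₀).comp hx₀) (hlim.comp hφ.tendsto_atTop)
  have hone : ‖x₀‖ = 1 := tendsto_nhds_unique hx₀.norm (by simp [hx])
  rw [(map_eq_zero_iff _ hinj).1 hzero, norm_zero] at hone
  exact zero_ne_one hone

end CompactPerturbation

section HilbertSpaceOperators

variable {𝕜 H H' ι : Type*} [RCLike 𝕜] [NormedAddCommGroup H] [InnerProductSpace 𝕜 H]
  [NormedAddCommGroup H'] [InnerProductSpace 𝕜 H']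

theorem surjective_adjoint_of_antilipschitzWith [CompleteSpace H] [CompleteSpace H']
    {A : H →L[𝕜] H'} {c : NNReal} (hA : AntilipschitzWith c A) :
    Function.Surjective (ContinuousLinearMap.adjoint A) := by
  obtain ⟨δ, hδ, hδA⟩ := antilipschitzWith_iff_exists_mul_le_norm.1 ⟨c, hA⟩
  lift δ to NNReal using hδ.le
  have hunit : IsUnit (ContinuousLinearMap.adjoint A ∘L A) := by
    refine ContinuousLinearMap.isUnit_of_forall_le_norm_inner_map _
      (c := δ ^ 2) (pow_pos (NNReal.coe_pos.1 hδ) 2) fun x => ?_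
    rw [ContinuousLinearMap.comp_apply, ContinuousLinearMap.adjoint_inner_left,
      inner_self_eq_norm_sq_to_K, norm_pow, RCLike.norm_ofReal, abs_norm, NNReal.coe_pow,
      mul_comm, ← mul_pow]
    exact pow_le_pow_left₀ (by positivity) (hδA x) 2
  exact .of_comp (ContinuousLinearMap.isUnit_iff_bijective.1 hunit).surjective

lemma eq_of_forall_hilbertBasis {F : Type*} [AddCommGroup F] [Module 𝕜 F] [TopologicalSpace F]
    [T2Space F] (b : HilbertBasis ι 𝕜 H) {S T : H →L[𝕜] F} (h : ∀ i, S (b i) = T (b i)) :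
    S = T := by
  refine ContinuousLinearMap.ext_on (s := Set.range b) ?_ (Set.forall_mem_range.2 h)
  exact (Submodule.dense_iff_topologicalClosure_eq_top).2 b.dense_span

lemma exists_linearIsometry_of_orthonormal [CompleteSpace H'] (b : HilbertBasis ι 𝕜 H) {v : ι → H'}
    (hv : Orthonormal 𝕜 v) : ∃ U : H →ₗᵢ[𝕜] H', ∀ i, U (b i) = v i := by
  classical
  refine ⟨hv.orthogonalFamily.linearIsometry.comp b.repr.toLinearIsometry, fun i => ?_⟩
  simp [b.repr_self, hv.orthogonalFamily.linearIsometry_apply_single]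

end HilbertSpaceOperators

section RankOneSums

open InnerProductSpace

variable {𝕜 H H' ι : Type*} [RCLike 𝕜] [NormedAddCommGroup H] [InnerProductSpace 𝕜 H]
  [NormedAddCommGroup H'] [InnerProductSpace 𝕜 H']

lemma norm_sum_rankOne_le {b : ι → H} (hb : Orthonormal 𝕜 b) (v : ι → H') (s : Finset ι) :
    ‖∑ i ∈ s, rankOne 𝕜 (v i) (b i)‖ ≤ √(∑ i ∈ s, ‖v i‖ ^ 2) := by
  refine ContinuousLinearMap.opNorm_le_bound _ (Real.sqrt_nonneg _) fun x => ?_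
  calc ‖(∑ i ∈ s, rankOne 𝕜 (v i) (b i)) x‖
      = ‖∑ i ∈ s, inner 𝕜 (b i) x • v i‖ := by simp
    _ ≤ ∑ i ∈ s, ‖v i‖ * ‖inner 𝕜 (b i) x‖ :=
        norm_sum_le_of_le _ fun i _ => by rw [norm_smul, mul_comm]
    _ ≤ √(∑ i ∈ s, ‖v i‖ ^ 2) * √(∑ i ∈ s, ‖inner 𝕜 (b i) x‖ ^ 2) :=
        Real.sum_mul_le_sqrt_mul_sqrt _ _ _
    _ ≤ √(∑ i ∈ s, ‖v i‖ ^ 2) * ‖x‖ := by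
        gcongr
        exact Real.sqrt_le_iff.2 ⟨norm_nonneg x, hb.sum_inner_products_le x⟩

lemma isCompactOperator_rankOne (x : H') (y : H) : IsCompactOperator (rankOne 𝕜 x y) := by
  rw [rankOne_def']
  exact (isCompactOperator_of_locallyCompactSpace_dom (innerSL 𝕜 y)).clm_comp
    (ContinuousLinearMap.toSpanSingleton 𝕜 x)

variable [CompleteSpace H']

lemma summable_rankOne {b : ι → H} (hb : Orthonormal 𝕜 b) {v : ι → H'}
    (hv : Summable fun i => ‖v i‖ ^ 2) : Summable fun i => rankOne 𝕜 (v i) (b i) := by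
  rw [summable_iff_vanishing_norm] at hv ⊢
  intro ε hε
  obtain ⟨s, hs⟩ := hv (ε ^ 2) (by positivity)
  refine ⟨s, fun t ht => (norm_sum_rankOne_le hb v t).trans_lt ?_⟩
  rw [Real.sqrt_lt' hε]
  exact (Real.le_norm_self _).trans_lt (hs t ht)

lemma tsum_rankOne_apply {b : ι → H} (hb : Orthonormal 𝕜 b) {v : ι → H'}
    (hv : Summable fun i => ‖v i‖ ^ 2) (j : ι) :
    (∑' i, rankOne 𝕜 (v i) (b i)) (b j) = v j := by
  classical
  have h := (summable_rankOne hb hv).hasSum.mapL (ContinuousLinearMap.apply 𝕜 H' (b j))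
  refine h.unique ?_
  convert hasSum_ite_eq j (v j) using 2 with i
  rw [ContinuousLinearMap.apply_apply, rankOne_apply, orthonormal_iff_ite.1 hb]
  split_ifs with hij <;> simp [hij]

lemma isCompactOperator_tsum {κ E F : Type*} [NormedAddCommGroup E] [NormedSpace 𝕜 E]
    [NormedAddCommGroup F] [NormedSpace 𝕜 F] [CompleteSpace F] {S : κ → E →L[𝕜] F}
    (hS : ∀ i, IsCompactOperator (S i)) : IsCompactOperator ⇑(∑' i, S i) := by
  by_cases hsum : Summable S
  · refine isCompactOperator_of_tendsto hsum.hasSum (Eventually.of_forall fun s => ?_)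
    exact (compactOperator (RingHom.id 𝕜) E F).sum_mem fun i _ => hS i
  · rw [tsum_eq_zero_of_not_summable hsum]
    exact isCompactOperator_zero

end RankOneSums

theorem IsHilbertSchmidt.isCompactOperator {H : Type} [NormedAddCommGroup H]
    [InnerProductSpace ℂ H] [CompleteSpace H] {T : H →L[ℂ] H} (hT : IsHilbertSchmidt T) :
    IsCompactOperator T := by
  obtain ⟨ι, b, hb⟩ := hT
  have hsum : T = ∑' i, InnerProductSpace.rankOne ℂ (T (b i)) (b i) :=
    eq_of_forall_hilbertBasis b fun i => (tsum_rankOne_apply b.orthonormal hb i).symm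
  rw [hsum]
  exact isCompactOperator_tsum fun i => isCompactOperator_rankOne (T (b i)) (b i)

section GradedBasis

variable {𝕜 H ι κ : Type*} [RCLike 𝕜] [NormedAddCommGroup H] [InnerProductSpace 𝕜 H]

theorem isHilbertSum_span_image_preimage [CompleteSpace H] (b : HilbertBasis ι 𝕜 H) (d : ι → κ)
    (hd : ∀ n, (d ⁻¹' {n}).Finite) :
    IsHilbertSum 𝕜 (fun n => Submodule.span 𝕜 (b '' (d ⁻¹' {n})))
      (fun n => (Submodule.span 𝕜 (b '' (d ⁻¹' {n}))).subtypeₗᵢ) := by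
  have hfin : ∀ n, FiniteDimensional 𝕜 (Submodule.span 𝕜 (b '' (d ⁻¹' {n}))) := fun n =>
    FiniteDimensional.span_of_finite 𝕜 ((hd n).image b)
  refine IsHilbertSum.mkInternal _ ?_ ?_
  · refine OrthogonalFamily.of_pairwise fun k n hkn => ?_
    rw [Function.onFun, Submodule.isOrtho_span]
    rintro _ ⟨i, rfl, rfl⟩ _ ⟨j, rfl, rfl⟩
    exact b.orthonormal.2 fun h => hkn (congrArg d h)
  · rw [← b.dense_span]
    refine Submodule.topologicalClosure_mono (Submodule.span_le.2 ?_)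
    rintro _ ⟨i, rfl⟩
    exact Submodule.mem_iSup_of_mem (d i) (Submodule.subset_span ⟨i, rfl, rfl⟩)

end GradedBasis

section CyclicVectors

variable {𝕜 H : Type*} [RCLike 𝕜] [NormedAddCommGroup H] [InnerProductSpace 𝕜 H] [CompleteSpace H]

lemma eq_zero_of_adjoint_eq_smul_of_dense_span_pow {M : H →L[𝕜] H} {s : Set H}
    (hs : (Submodule.span 𝕜 {y | ∃ (i : ℕ), ∃ x ∈ s, (M ^ i) x = y}).topologicalClosure = ⊤)
    {c : 𝕜} {v : H} (hv : ContinuousLinearMap.adjoint M v = c • v)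
    (hsv : ∀ x ∈ s, inner 𝕜 x v = 0) : v = 0 := by
  have hpow : ∀ (i : ℕ), ∀ x ∈ s, inner 𝕜 ((M ^ i) x) v = 0 := by
    intro i x hx
    induction i with
    | zero => simpa using hsv x hx
    | succ i ih =>
      rw [pow_succ', mul_apply_eq_comp, ← ContinuousLinearMap.adjoint_inner_right, hv,
        inner_smul_right, ih, mul_zero]
  have hle : Submodule.span 𝕜 {y | ∃ (i : ℕ), ∃ x ∈ s, (M ^ i) x = y} ≤ (𝕜 ∙ v)ᗮ := by
    refine Submodule.span_le.2 ?_
    rintro _ ⟨i, x, hx, rfl⟩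
    exact Submodule.mem_orthogonal_singleton_iff_inner_left.2 (hpow i x hx)
  exact (Submodule.dense_iff_topologicalClosure_eq_top.2 hs).eq_zero_of_inner_right 𝕜
    fun y hy => Submodule.mem_orthogonal_singleton_iff_inner_left.1 (hle hy)

lemma mem_spectrum_of_ker_sub_smul_id_ne_bot {E : Type*} [NormedAddCommGroup E] [NormedSpace 𝕜 E]
    {T : E →L[𝕜] E} {c : 𝕜} (h : (T - c • ContinuousLinearMap.id 𝕜 E).ker ≠ ⊥) :
    c ∈ spectrum 𝕜 T := by
  refine spectrum.mem_iff.2 fun hunit => h ?_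
  have hend : IsUnit (T - c • ContinuousLinearMap.id 𝕜 E : E →ₗ[𝕜] E) := by
    simpa [Algebra.algebraMap_eq_smul_one, Module.End.one_eq_id] using
      (hunit.map ContinuousLinearMap.toLinearMapRingHom).neg
  exact LinearMap.ker_eq_bot.2 ((Module.End.isUnit_iff _).1 hend).injective

end CyclicVectors

section MultiplicationOperators

variable {𝕜 X V H : Type*} [RCLike 𝕜] [NormedAddCommGroup V] [InnerProductSpace 𝕜 V]
  [NormedAddCommGroup H] [InnerProductSpace 𝕜 H] [RKHS 𝕜 H X V]

/-- `M` is the operator of multiplication by the scalar function `φ` on a space of vector-valued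
functions. -/
def IsMulOperator (M : H →L[𝕜] H) (φ : X → 𝕜) : Prop :=
  ∀ (F : H) (x : X), M F x = φ x • F x

variable {M : H →L[𝕜] H} {φ : X → 𝕜}

lemma isMulOperator_of_hilbertBasis {ι : Type*} (b : HilbertBasis ι 𝕜 H)
    (h : ∀ i x, M (b i) x = φ x • b i x) : IsMulOperator M φ := by
  intro F x
  let eval : H →L[𝕜] V := .proj x ∘L RKHS.coeCLM 𝕜
  have heval : eval ∘L M = φ x • eval := eq_of_forall_hilbertBasis b (h · x)
  exact DFunLike.congr_fun heval F

lemma IsMulOperator.pow (hM : IsMulOperator M φ) (i : ℕ) : IsMulOperator (M ^ i) (φ ^ i) := by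
  intro F x
  induction i with
  | zero => simp
  | succ i ih =>
    rw [pow_succ', mul_apply_eq_comp, hM, ih, smul_smul, pow_succ', Pi.mul_apply]

lemma IsMulOperator.injective_sub_smul_id [TopologicalSpace X] (hM : IsMulOperator M φ)
    (hcont : ∀ F : H, Continuous F) {c : 𝕜} (hφ : Dense {x | φ x ≠ c}) :
    Function.Injective (M - c • ContinuousLinearMap.id 𝕜 H) := by
  refine (injective_iff_map_eq_zero _).2 fun F hF => ?_
  have hzero : Set.EqOn F 0 {x | φ x ≠ c} := by
    intro x hx
    have h : (M - c • ContinuousLinearMap.id 𝕜 H) F x = (φ x - c) • F x := by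
      simp [hM F x, sub_smul]
    rw [hF, RKHS.coe_zero, Pi.zero_apply, eq_comm, smul_eq_zero] at h
    exact h.resolve_left (sub_ne_zero.2 hx)
  exact DFunLike.coe_injective (RKHS.coe_zero (H := H) ▸ (hcont F).ext_on hφ continuous_zero hzero)

variable [CompleteSpace H] [CompleteSpace V]

lemma IsMulOperator.adjoint_kerFun (hM : IsMulOperator M φ) (x : X) (v : V) :
    ContinuousLinearMap.adjoint M (RKHS.kerFun H x v) = conj (φ x) • RKHS.kerFun H x v := by
  refine ext_inner_right 𝕜 fun F => ?_
  rw [ContinuousLinearMap.adjoint_inner_left, RKHS.kerFun_inner, hM, inner_smul_right,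
    inner_smul_left, RKHS.kerFun_inner, RCLike.conj_conj]

lemma adjoint_const_kerFun {const : V →L[𝕜] H} (hconst : ∀ v x, const v x = v) (x : X) (v : V) :
    ContinuousLinearMap.adjoint const (RKHS.kerFun H x v) = v := by
  refine ext_inner_right 𝕜 fun w => ?_
  rw [ContinuousLinearMap.adjoint_inner_left, RKHS.kerFun_inner, hconst]

/-- If `k` is an eigenvector, then so is its difference from the kernel function of its
projection to the constants; the latter is orthogonal to the constants, hence zero. -/
theorem IsMulOperator.ker_adjoint_sub_eq_range_kerFun (hM : IsMulOperator M φ)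
    {const : V →L[𝕜] H} (hconst : ∀ v x, const v x = v)
    (hcyclic : (Submodule.span 𝕜
      {F | ∃ (i : ℕ), ∃ G ∈ Set.range const, (M ^ i) G = F}).topologicalClosure = ⊤) (x : X) :
    (ContinuousLinearMap.adjoint M - conj (φ x) • ContinuousLinearMap.id 𝕜 H).ker =
      (RKHS.kerFun H x).range := by
  ext F
  rw [LinearMap.mem_ker]
  constructor
  · intro hF
    have hF' : ContinuousLinearMap.adjoint M F = conj (φ x) • F := sub_eq_zero.1 hF
    refine ⟨ContinuousLinearMap.adjoint const F, (sub_eq_zero.1 ?_).symm⟩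
    refine eq_zero_of_adjoint_eq_smul_of_dense_span_pow hcyclic (c := conj (φ x)) ?_ ?_
    · rw [map_sub, hF', smul_sub]
      exact congrArg _ (hM.adjoint_kerFun x _)
    · rintro _ ⟨v, rfl⟩
      rw [← ContinuousLinearMap.adjoint_inner_right, map_sub, sub_eq_zero.2, inner_zero_right]
      exact (adjoint_const_kerFun hconst x _).symm
  · rintro ⟨v, rfl⟩
    exact sub_eq_zero.2 (hM.adjoint_kerFun x v)

end MultiplicationOperators

section Disc

lemma dense_setOf_coe_unitDisc_ne (c : ℂ) : Dense {z : 𝔻 | (z : ℂ) ≠ c} :=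
  (dense_compl_singleton c).preimage Metric.isOpen_ball.isOpenMap_subtype_val

lemma exists_antilipschitzWith_sub_smul_id {H : Type*} [NormedAddCommGroup H] [NormedSpace ℂ H]
    (U : H →ₗᵢ[ℂ] H) (a : 𝔻) : ∃ c, AntilipschitzWith c
      (U.toContinuousLinearMap - (a : ℂ) • ContinuousLinearMap.id ℂ H) := by
  have hU : AntilipschitzWith 1 U := U.antilipschitz
  have ha : LipschitzWith ‖-(a : ℂ)‖₊ fun x : H => -(a : ℂ) • x := lipschitzWith_smul _
  have ha₁ : ‖-(a : ℂ)‖₊ < 1⁻¹ := by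
    rw [inv_one, nnnorm_neg]
    exact a.norm_lt_one
  have h := hU.add_lipschitzWith ha ha₁
  simp only [neg_smul, ← sub_eq_add_neg] at h
  exact ⟨_, h⟩

variable {V H : Type*} [NormedAddCommGroup V] [InnerProductSpace ℂ V]
  [NormedAddCommGroup H] [InnerProductSpace ℂ H] [CompleteSpace H] [RKHS ℂ H 𝔻 V]
  {M : H →L[ℂ] H}

theorem IsMulOperator.surjective_adjoint_sub (hM : IsMulOperator M fun z : 𝔻 => (z : ℂ))
    (hcont : ∀ F : H, Continuous F) {U : H →ₗᵢ[ℂ] H}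
    (hMU : IsCompactOperator (M - U.toContinuousLinearMap)) (a : 𝔻) :
    Function.Surjective
      (ContinuousLinearMap.adjoint M - conj (a : ℂ) • ContinuousLinearMap.id ℂ H) := by
  have hinj : Function.Injective (M - (a : ℂ) • ContinuousLinearMap.id ℂ H) :=
    hM.injective_sub_smul_id hcont (dense_setOf_coe_unitDisc_ne a)
  obtain ⟨c, hc⟩ := exists_antilipschitzWith_sub_smul_id U a
  have hsplit : M - (a : ℂ) • ContinuousLinearMap.id ℂ H =
      (U.toContinuousLinearMap - (a : ℂ) • ContinuousLinearMap.id ℂ H) +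
        (M - U.toContinuousLinearMap) := by abel
  rw [hsplit] at hinj
  obtain ⟨c', hc'⟩ := exists_antilipschitzWith_add_isCompactOperator hc hMU hinj
  rw [← hsplit] at hc'
  simpa only [map_sub, map_smulₛₗ, ContinuousLinearMap.adjoint_id] using
    surjective_adjoint_of_antilipschitzWith hc'

theorem IsMulOperator.isCowenDouglas_adjoint [FiniteDimensional ℂ V] [Nontrivial V]
    (hM : IsMulOperator M fun z : 𝔻 => (z : ℂ))
    (hcont : ∀ F : H, Continuous F) {U : H →ₗᵢ[ℂ] H}
    (hMU : IsCompactOperator (M - U.toContinuousLinearMap))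
    {const : V →L[ℂ] H} (hconst : ∀ v x, const v x = v)
    (hcyclic : (Submodule.span ℂ
      {F | ∃ (i : ℕ), ∃ G ∈ Set.range const, (M ^ i) G = F}).topologicalClosure = ⊤) :
    IsCowenDouglas (ContinuousLinearMap.adjoint M) (Metric.ball 0 1) (Module.finrank ℂ V) := by
  have := FiniteDimensional.complete ℂ V
  have hdisc : ∀ w ∈ Metric.ball (0 : ℂ) 1, ∃ a : 𝔻, conj (a : ℂ) = w := fun w hw =>
    ⟨star (.mk w (mem_ball_zero_iff.1 hw)), by simp⟩
  have hker := hM.ker_adjoint_sub_eq_range_kerFun hconst hcyclic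
  have hfinrank : ∀ w ∈ Metric.ball (0 : ℂ) 1, Module.finrank ℂ (ContinuousLinearMap.adjoint M -
      w • ContinuousLinearMap.id ℂ H).ker = Module.finrank ℂ V := by
    intro w hw
    obtain ⟨a, rfl⟩ := hdisc w hw
    rw [hker a]
    exact LinearMap.finrank_range_of_inj
      (Function.LeftInverse.injective (adjoint_const_kerFun hconst a))
  have hpos : 0 < Module.finrank ℂ V := Module.finrank_pos
  refine ⟨fun w hw => ?_, fun w hw => ?_, ?_, fun w hw => ?_, hfinrank⟩
  · refine mem_spectrum_of_ker_sub_smul_id_ne_bot fun hbot => ?_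
    rw [← hfinrank w hw, hbot, finrank_bot] at hpos
    exact hpos.false
  · obtain ⟨a, rfl⟩ := hdisc w hw
    exact hM.surjective_adjoint_sub hcont hMU a
  · rw [eq_top_iff, ← RKHS.kerFun_dense (H := H)]
    refine Submodule.topologicalClosure_mono (Submodule.span_le.2 ?_)
    rintro _ ⟨a, v, rfl⟩
    refine Submodule.mem_iSup_of_mem (conj (a : ℂ)) (Submodule.mem_iSup_of_mem ?_ ?_)
    · simpa using a.norm_lt_one
    · rw [hker a]
      exact ⟨v, rfl⟩
  · exact FiniteDimensional.of_finrank_pos (hpos.trans_eq (hfinrank w hw).symm)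

end Disc

section Pochhammer

lemma poch_zero (x : ℝ) : poch x 0 = 1 := by simp [poch]

lemma poch_add (x : ℝ) (a b : ℕ) : poch x (a + b) = poch x a * poch (x + a) b := by
  simp only [poch, ← ascPochhammer_mul ℝ a b, Polynomial.eval_mul, Polynomial.eval_comp,
    Polynomial.eval_add, Polynomial.eval_X, Polynomial.eval_natCast]

lemma poch_succ (x : ℝ) (n : ℕ) : poch x (n + 1) = poch x n * (x + n) :=
  ascPochhammer_succ_eval n x

lemma pow_le_poch {x : ℝ} (hx : 0 ≤ x) (n : ℕ) : x ^ n ≤ poch x n := by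
  induction n with
  | zero => simp [poch_zero]
  | succ n ih =>
    rw [poch_succ, pow_succ]
    exact mul_le_mul ih (le_add_of_nonneg_right (by positivity)) hx ((pow_nonneg hx n).trans ih)

/-- With `u d = (r)(r - 1) ⋯ (r - d) / (x)_{r+d}` the summands are `u d - u (d + 1)`. -/
lemma sum_descFactorial_mul_div_poch {x : ℝ} (hx : 0 < x) (r : ℕ) :
    ∑ d ∈ Finset.range r, r.descFactorial (d + 1) * (x + 2 * d + 1) / poch x (r + d + 1) =
      r / poch x r := by
  have hstep : ∀ d ∈ Finset.range r,
      r.descFactorial (d + 1) * (x + 2 * d + 1) / poch x (r + d + 1) =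
        r.descFactorial (d + 1) / poch x (r + d) -
          r.descFactorial (d + 1 + 1) / poch x (r + (d + 1)) := by
    intro d hd
    have hpoch := poch_pos hx (r + d)
    rw [← add_assoc r d 1, poch_succ, Nat.descFactorial_succ r (d + 1), Nat.cast_mul,
      Nat.cast_sub (Finset.mem_range.1 hd)]
    push_cast
    field_simp
    ring
  rw [Finset.sum_congr rfl hstep, Finset.sum_range_sub']
  simp

/-- The coefficient of `f^(l-j)` in the component `l` of `Γ_j f`, where `x = 2λ - m`. -/
def gamCoef (x : ℝ) (j l : ℕ) : ℝ := l.choose j / poch (x + 2 * j) (l - j)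

lemma gamCoef_of_lt (x : ℝ) {j l : ℕ} (h : l < j) : gamCoef x j l = 0 := by
  simp [gamCoef, Nat.choose_eq_zero_of_lt h]

/-- The coefficients `c_{j,k}`, `j < k`, of the decomposition
`z Γ_j f = Γ_j (z f) - ∑_{k > j} c_{j,k} Γ_k f^(k-j-1)`, where `x = 2λ - m`. -/
def mulCoef (x : ℝ) (j k : ℕ) : ℝ := k.descFactorial (k - j) / poch (x + 2 * j) (2 * (k - j) - 1)

lemma gamCoef_mul_mulCoef {x : ℝ} (hx : 0 < x) {j r d : ℕ} (hd : d < r) :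
    gamCoef x (j + 1 + d) (j + r) * mulCoef x j (j + 1 + d) =
      (j + r).choose j * (r.descFactorial (d + 1) * (x + 2 * j + 2 * d + 1) /
        poch (x + 2 * j) (r + d + 1)) := by
  have hy : 0 < x + 2 * j := by positivity
  have hchoose : ((j + r).choose (j + 1 + d) * (j + 1 + d).descFactorial (d + 1) : ℝ) =
      (j + r).choose j * r.descFactorial (d + 1) := by
    have h := Nat.choose_mul (n := j + r) (k := j + 1 + d) (s := j) (by lia)
    rw [show j + r - j = r by lia, show j + 1 + d - j = d + 1 by lia,
      Nat.choose_symm_of_eq_add (show j + 1 + d = j + (d + 1) by lia)] at h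
    rw [Nat.descFactorial_eq_factorial_mul_choose, Nat.descFactorial_eq_factorial_mul_choose]
    norm_cast
    linear_combination (d + 1).factorial * h
  have hpoch : poch (x + 2 * j) (r + d + 1) = poch (x + 2 * j) (2 * d + 1) *
      (x + 2 * j + 2 * d + 1) * poch (x + 2 * (j + 1 + d : ℕ)) (r - (d + 1)) := by
    rw [show r + d + 1 = 2 * d + 1 + 1 + (r - (d + 1)) by lia, poch_add, poch_succ]
    push_cast
    ring_nf
  have hpos₁ := poch_pos hy (2 * d + 1)
  have hpos₂ := poch_pos (x := x + 2 * (j + 1 + d : ℕ)) (by positivity) (r - (d + 1))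
  rw [gamCoef, mulCoef, hpoch, show j + r - (j + 1 + d) = r - (d + 1) by lia,
    show j + 1 + d - j = d + 1 by lia, show 2 * (d + 1) - 1 = 2 * d + 1 by lia]
  field_simp
  linear_combination hchoose

theorem sum_gamCoef_mul_mulCoef {x : ℝ} (hx : 0 < x) (j l : ℕ) :
    ∑ k ∈ Finset.Ioc j l, gamCoef x k l * mulCoef x j k = (l - j : ℕ) * gamCoef x j l := by
  rcases lt_or_ge l j with hlj | hjl
  · simp [gamCoef_of_lt x hlj, hlj.le]
  obtain ⟨r, rfl⟩ := Nat.exists_eq_add_of_le hjl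
  rw [← Finset.Ico_add_one_add_one_eq_Ioc, Finset.sum_Ico_eq_sum_range,
    show j + r + 1 - (j + 1) = r by lia,
    Finset.sum_congr rfl fun d hd => gamCoef_mul_mulCoef hx (Finset.mem_range.1 hd),
    ← Finset.mul_sum, sum_descFactorial_mul_div_poch (by positivity), gamCoef,
    Nat.add_sub_cancel_left]
  ring

end Pochhammer

section MonomialWeights

variable {ν : ℝ}

lemma coef_sq_eq_div (hν : 0 < ν) (n : ℕ) : coef ν n ^ 2 = poch (2 * ν) n / n.factorial :=
  Real.sq_sqrt (div_pos (poch_pos (by positivity) n) (by positivity)).le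

lemma sq_coef_div_coef_succ (hν : 0 < ν) (n : ℕ) :
    (coef ν n / coef ν (n + 1)) ^ 2 = (n + 1) / (2 * ν + n) := by
  have hpoch := poch_pos (x := 2 * ν) (by positivity) n
  rw [div_pow, coef_sq_eq_div hν, coef_sq_eq_div hν, poch_succ, Nat.factorial_succ]
  push_cast
  field_simp

lemma abs_coef_div_coef_succ_sub_one_le (hν : 0 < ν) (n : ℕ) :
    |coef ν n / coef ν (n + 1) - 1| ≤ |1 - 2 * ν| / (2 * ν + n) := by
  have hsq := sq_coef_div_coef_succ hν n
  have ht : 0 < coef ν n / coef ν (n + 1) := div_pos (coef_pos hν _) (coef_pos hν _)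
  set t := coef ν n / coef ν (n + 1)
  have hn : (0 : ℝ) < 2 * ν + n := by positivity
  calc |t - 1| ≤ |t - 1| * (t + 1) := le_mul_of_one_le_right (abs_nonneg _) (by linarith)
    _ = |(t - 1) * (t + 1)| := by rw [abs_mul, abs_of_pos (show 0 < t + 1 by linarith)]
    _ = |(1 - 2 * ν) / (2 * ν + n)| := by
        rw [show (t - 1) * (t + 1) = t ^ 2 - 1 by ring, hsq, div_sub_one hn.ne']
        ring_nf
    _ = |1 - 2 * ν| / (2 * ν + n) := by rw [abs_div, abs_of_pos hn]

lemma sq_coef_mul_descFactorial_div_coef (hν : 0 < ν) {d n : ℕ} (hdn : d ≤ n) :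
    (coef ν n * n.descFactorial d / coef (ν + (d + 1)) (n - d)) ^ 2 =
      n.descFactorial d * poch (2 * ν) (2 * d + 2) / poch (2 * ν + n) (d + 2) := by
  have hpoch : poch (2 * ν) (2 * d + 2) * poch (2 * (ν + (d + 1))) (n - d) =
      poch (2 * ν) n * poch (2 * ν + n) (d + 2) := by
    rw [show 2 * (ν + (d + 1)) = 2 * ν + ((2 * d + 2 : ℕ) : ℝ) by push_cast; ring, ← poch_add,
      ← poch_add, show n + (d + 2) = (2 * d + 2) + (n - d) by lia]
  have hpos₁ := poch_pos (x := 2 * (ν + (d + 1))) (by positivity) (n - d)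
  have hpos₂ := poch_pos (x := 2 * ν + n) (by positivity) (d + 2)
  have hfact : (n.factorial : ℝ) = (n - d).factorial * n.descFactorial d := by
    exact_mod_cast (Nat.factorial_mul_descFactorial hdn).symm
  have hdesc : (0 : ℝ) < n.descFactorial d := by exact_mod_cast Nat.descFactorial_pos.2 hdn
  rw [div_pow, mul_pow, coef_sq_eq_div hν, coef_sq_eq_div (by positivity), hfact]
  field_simp
  linear_combination -hpoch

lemma coef_mul_descFactorial_div_coef_le (hν : 0 < ν) (d n : ℕ) :
    coef ν n * n.descFactorial d / coef (ν + (d + 1)) (n - d) ≤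
      √(poch (2 * ν) (2 * d + 2)) / (2 * ν + n) := by
  have hn : (0 : ℝ) < 2 * ν + n := by positivity
  rcases lt_or_ge n d with hnd | hdn
  · rw [Nat.descFactorial_of_lt hnd, Nat.cast_zero, mul_zero, zero_div]
    positivity
  have hpoch := poch_pos (x := 2 * ν) (by positivity) (2 * d + 2)
  have hdesc : (n.descFactorial d : ℝ) * (2 * ν + n) ^ 2 ≤ poch (2 * ν + n) (d + 2) :=
    calc (n.descFactorial d : ℝ) * (2 * ν + n) ^ 2 ≤ (n : ℝ) ^ d * (2 * ν + n) ^ 2 := by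
          gcongr
          exact_mod_cast n.descFactorial_le_pow d
      _ ≤ (2 * ν + n) ^ d * (2 * ν + n) ^ 2 := by gcongr; linarith
      _ = (2 * ν + n) ^ (d + 2) := (pow_add _ _ _).symm
      _ ≤ poch (2 * ν + n) (d + 2) := pow_le_poch hn.le _
  refine le_of_sq_le_sq ?_ (by positivity)
  rw [sq_coef_mul_descFactorial_div_coef hν hdn, div_pow, Real.sq_sqrt hpoch.le,
    div_le_div_iff₀ (poch_pos hn _) (by positivity), mul_right_comm,
    mul_comm (poch (2 * ν) _)]
  gcongr

lemma one_div_add_natCast_le {x : ℝ} (hx : 0 < x) (n : ℕ) :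
    1 / (x + n) ≤ (1 + 1 / x) / (n + 1) := by
  have h : (1 + 1 / x) * (x + n) = n + 1 + (x + n / x) := by field_simp; ring
  rw [div_le_div_iff₀ (by positivity) (by positivity), h, one_mul]
  exact le_add_of_nonneg_right (by positivity)

end MonomialWeights

section Derivatives

variable {ν : {x : ℝ // 0 < x}}

lemma derivDisc_monomial (k n : ℕ) (z : 𝔻) :
    derivDisc k (monomial ν n) z = n.descFactorial k * (z : ℂ) ^ (n - k) := by
  have h : ext0 (monomial ν n) =ᶠ[𝓝 (z : ℂ)] fun x => x ^ n := by
    filter_upwards [Metric.isOpen_ball.mem_nhds (mem_ball_zero_iff.2 z.norm_lt_one)] with x hx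
    rw [ext0, dif_pos (mem_ball_zero_iff.1 hx), monomial_apply, Complex.UnitDisc.coe_mk]
  rw [derivDisc, h.iteratedDeriv_eq, iteratedDeriv_pow]

lemma continuous_derivDisc_apply (k : ℕ) (f : DiscSpace ν) : Continuous (derivDisc k f) := by
  refine continuous_iff_continuousAt.2 fun z => ?_
  have h : ContinuousAt (iteratedDeriv k (ext0 f)) z := by
    rw [iteratedDeriv_eq_iterate]
    exact ((analyticAt_discSpace f z).iterated_deriv k).continuousAt
  exact h.comp (f := fun z : 𝔻 => (z : ℂ)) continuous_subtype_val.continuousAt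

end Derivatives

variable {m : ℕ} (p : Params m)

section Gamma

lemma two_mul_lamj (j : Fin (m + 1)) : 2 * (p.lamj j : ℝ) = 2 * p.lam - m + 2 * (j : ℕ) := by
  simp only [Params.lamj]
  ring

lemma lamj_eq_add {j k : Fin (m + 1)} (hjk : j < k) :
    (p.lamj k : ℝ) = p.lamj j + ((k - j - 1 : ℕ) + 1) := by
  obtain ⟨d, hd⟩ := Nat.exists_eq_add_of_lt (show (j : ℕ) < k from hjk)
  simp only [Params.lamj, hd, show (j : ℕ) + d + 1 - j - 1 = d by lia]
  push_cast
  ring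

lemma continuous_Gam_apply {j : Fin (m + 1)} (f : DiscSpace (p.lamj j)) :
    Continuous (Gam p j f) := by
  refine (PiLp.continuous_toLp 2 _).comp (continuous_pi fun l => ?_)
  by_cases h : j ≤ l
  · simp only [h, if_true]
    exact continuous_const.mul (continuous_derivDisc_apply _ f)
  · simpa only [h, if_false] using continuous_const

lemma Gam_monomial_apply (j l : Fin (m + 1)) (n : ℕ) (z : 𝔻) :
    Gam p j (monomial (p.lamj j) n) z l =
      gamCoef (2 * p.lam - m) j l * (n.descFactorial (l - j) * (z : ℂ) ^ (n - (l - j))) := by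
  rcases lt_or_ge l j with h | h
  · simp [Gam, not_le.2 h, gamCoef_of_lt _ (Fin.lt_def.1 h)]
  · simp only [Gam, h, if_true, derivDisc_monomial, gamCoef, two_mul_lamj]

/-- Leibniz' rule for the `r`-th derivative of `z · z^n`. -/
lemma mul_descFactorial_mul_pow {R : Type*} [CommRing R] (z : R) (n r : ℕ) :
    z * (n.descFactorial r * z ^ (n - r)) = (n + 1).descFactorial r * z ^ (n + 1 - r) -
      r * (n.descFactorial (r - 1) * z ^ (n - (r - 1))) := by
  cases r with
  | zero => simp [pow_succ']
  | succ i =>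
    rw [Nat.succ_descFactorial_succ, Nat.descFactorial_succ, Nat.add_sub_cancel,
      Nat.add_sub_add_right]
    rcases lt_trichotomy n i with h | rfl | h
    · simp [Nat.descFactorial_of_lt h]
    · simp
    · obtain ⟨d, rfl⟩ := Nat.exists_eq_add_of_lt h
      rw [show i + d + 1 - i = d + 1 by lia, show i + d + 1 - (i + 1) = d by lia]
      push_cast
      ring

lemma sum_mulCoef_mul_Gam_monomial_apply (j l : Fin (m + 1)) (n : ℕ) (z : 𝔻) :
    ∑ k ∈ Finset.Ioi j, ((mulCoef (2 * p.lam - m) j k * n.descFactorial (k - j - 1) : ℝ) : ℂ) *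
      Gam p k (monomial (p.lamj k) (n - (k - j - 1))) z l =
        gamCoef (2 * p.lam - m) j l * ((l - j : ℕ) *
          (n.descFactorial (l - j - 1) * (z : ℂ) ^ (n - (l - j - 1)))) := by
  set x := 2 * p.lam - m
  have hterm : ∀ k ∈ Finset.Ioc j l,
      ((mulCoef x j k * n.descFactorial (k - j - 1) : ℝ) : ℂ) *
        Gam p k (monomial (p.lamj k) (n - (k - j - 1))) z l =
          ((gamCoef x k l * mulCoef x j k : ℝ) : ℂ) *
            (n.descFactorial (l - j - 1) * (z : ℂ) ^ (n - (l - j - 1))) := by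
    intro k hk
    have hjk : (j : ℕ) < k := (Finset.mem_Ioc.1 hk).1
    have hkl : (k : ℕ) ≤ l := (Finset.mem_Ioc.1 hk).2
    rw [Gam_monomial_apply, ← Nat.descFactorial_mul_descFactorial
      (show (k : ℕ) - j - 1 ≤ l - j - 1 by lia), show (l : ℕ) - j - 1 - (k - j - 1) = l - k by lia,
      show n - (k - j - 1) - ((l : ℕ) - k) = n - (l - j - 1) by lia]
    push_cast
    ring
  have hsum := sum_gamCoef_mul_mulCoef p.lam_gt j l
  rw [← Fin.map_valEmbedding_Ioc, Finset.sum_map] at hsum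
  rw [← Finset.sum_subset (fun k hk => Finset.mem_Ioi.2 (Finset.mem_Ioc.1 hk).1),
    Finset.sum_congr rfl hterm, ← Finset.sum_mul, ← Complex.ofReal_sum]
  · simp only [Fin.valEmbedding_apply] at hsum
    rw [hsum]
    push_cast
    ring
  · intro k hk hkl
    have hlk : (l : ℕ) < k := not_le.1 fun h => hkl (Finset.mem_Ioc.2 ⟨Finset.mem_Ioi.1 hk, h⟩)
    rw [Gam_monomial_apply, gamCoef_of_lt _ hlk, Complex.ofReal_zero, zero_mul, mul_zero]

theorem smul_Gam_monomial (j : Fin (m + 1)) (n : ℕ) (z : 𝔻) :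
    (z : ℂ) • Gam p j (monomial (p.lamj j) n) z =
      Gam p j (monomial (p.lamj j) (n + 1)) z - ∑ k ∈ Finset.Ioi j,
        ((mulCoef (2 * p.lam - m) j k * n.descFactorial (k - j - 1) : ℝ) : ℂ) •
          Gam p k (monomial (p.lamj k) (n - (k - j - 1))) z := by
  ext l
  simp only [PiLp.smul_apply, PiLp.sub_apply, WithLp.ofLp_sum, Finset.sum_apply, smul_eq_mul,
    sum_mulCoef_mul_Gam_monomial_apply]
  rw [Gam_monomial_apply, Gam_monomial_apply, mul_left_comm, mul_descFactorial_mul_pow, mul_sub]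

end Gamma

section Basis

lemma mu_ne_zero (j : Fin (m + 1)) : (p.mu j : ℂ) ≠ 0 := by exact_mod_cast (p.mu_pos j).ne'

lemma coef_lamj_ne_zero (j : Fin (m + 1)) (n : ℕ) : (coef (p.lamj j) n : ℂ) ≠ 0 := by
  exact_mod_cast (coef_pos (p.lamj j).2 n).ne'

lemma inner_mu_e (j : Fin (m + 1)) (n : ℕ) (F : VecSpace p) :
    inner ℂ ((p.mu j : ℂ) • e p j n) F = (F.comp j).coeff n := by
  have hcomp : ((p.mu j : ℂ) • e p j n).comp j =
      (lp.single 2 n (1 : ℂ) : lp (fun _ : ℕ => ℂ) 2) := by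
    rw [comp_smul, e, embed_comp_self, smul_inv_smul₀ (mu_ne_zero p j)]
    refine (lp.single_smul 2 n _ _).symm.trans ?_
    rw [smul_eq_mul, Complex.ofReal_inv, mul_inv_cancel₀ (coef_lamj_ne_zero p j n)]
  refine (PiLp.inner_apply (𝕜 := ℂ) _ _).trans ?_
  rw [Finset.sum_eq_single j]
  · refine (congrArg (inner ℂ · (F.comp j)) hcomp).trans ?_
    refine (lp.inner_single_left (𝕜 := ℂ) (G := fun _ : ℕ => ℂ) n 1 _).trans ?_
    simp [DiscSpace.coeff]
  · intro i _ hij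
    have hzero : ((p.mu j : ℂ) • e p j n).comp i = 0 := by
      rw [comp_smul, e, embed_comp_ne hij, smul_zero]
    exact (congrArg (inner ℂ · (F.comp i)) hzero).trans (inner_zero_left _)
  · exact fun hj => absurd (Finset.mem_univ j) hj

lemma eq_zero_of_forall_inner_mu_e_eq_zero {F : VecSpace p}
    (hF : ∀ j n, inner ℂ ((p.mu j : ℂ) • e p j n) F = 0) : F = 0 := by
  have hcomp : ∀ j, F.comp j = 0 := fun j => coeff_ext fun n => by
    rw [← inner_mu_e]
    exact hF j n
  exact PiLp.ext hcomp

/-- The orthonormal basis of the vectors `μ_j e_n^j`. -/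
def basis : HilbertBasis (Fin (m + 1) × ℕ) ℂ (VecSpace p) :=
  HilbertBasis.mkOfOrthogonalEqBot (orthonormal_mu_e p) <| by
    refine (Submodule.eq_bot_iff _).2 fun F hF => eq_zero_of_forall_inner_mu_e_eq_zero p ?_
    exact fun j n => (Submodule.mem_orthogonal _ _).1 hF _ (Submodule.subset_span ⟨(j, n), rfl⟩)

lemma basis_apply (j : Fin (m + 1)) (n : ℕ) : basis p (j, n) = (p.mu j : ℂ) • e p j n := by
  rw [basis, HilbertBasis.coe_mkOfOrthogonalEqBot]

lemma e_eq_smul_basis (j : Fin (m + 1)) (n : ℕ) : e p j n = (p.mu j : ℂ)⁻¹ • basis p (j, n) := by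
  rw [basis_apply, inv_smul_smul₀ (mu_ne_zero p j)]

lemma blockSpace_eq_span_basis :
    blockSpace p = fun n => Submodule.span ℂ (basis p '' ((fun a => a.2 + a.1) ⁻¹' {n})) := by
  funext n
  refine le_antisymm (Submodule.span_le.2 ?_) (Submodule.span_le.2 ?_)
  · rintro _ ⟨j, hj, rfl⟩
    rw [e_eq_smul_basis]
    exact Submodule.smul_mem _ _ (Submodule.subset_span ⟨(j, n - j), Nat.sub_add_cancel hj, rfl⟩)
  · rintro _ ⟨⟨j, i⟩, rfl, rfl⟩
    rw [basis_apply]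
    exact Submodule.smul_mem _ _ (Submodule.subset_span ⟨j, by simp, by simp⟩)

lemma e_apply (j : Fin (m + 1)) (n : ℕ) (z : 𝔻) :
    e p j n z = (coef (p.lamj j) n : ℂ) • Gam p j (monomial (p.lamj j) n) z := by
  rw [e, embed_apply, Gam_smul]

lemma sum_vecSpace_apply {ι : Type*} (s : Finset ι) (G : ι → VecSpace p) (z : 𝔻) :
    (∑ i ∈ s, G i) z = ∑ i ∈ s, G i z := by
  rw [← RKHS.coeCLM_apply (𝕜 := ℂ), map_sum, Finset.sum_apply]
  rfl

lemma continuous_vecSpace (F : VecSpace p) : Continuous F :=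
  (continuous_finsetSum _ fun j _ => (continuous_Gam_apply p (F.comp j)).const_smul
    (p.mu j : ℂ) : Continuous fun z => ∑ j, (p.mu j : ℂ) • Gam p j (F.comp j) z)

end Basis

section Entries

/-- The coefficient of `μ_k e_{n+1+j-k}^k` in `z μ_j e_n^j`: the entry at `(k, j)` of the block
`M(n + j)`. -/
def entry (k j : Fin (m + 1)) (n : ℕ) : ℝ :=
  if k = j then coef (p.lamj j) n / coef (p.lamj j) (n + 1)
  else if j < k then -(p.mu j / p.mu k * mulCoef (2 * p.lam - m) j k *
    (coef (p.lamj j) n * n.descFactorial (k - j - 1) / coef (p.lamj k) (n - (k - j - 1))))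
  else 0

variable {j k : Fin (m + 1)}

lemma entry_self (j : Fin (m + 1)) (n : ℕ) :
    entry p j j n = coef (p.lamj j) n / coef (p.lamj j) (n + 1) := if_pos rfl

lemma entry_of_lt (h : j < k) (n : ℕ) :
    entry p k j n = -(p.mu j / p.mu k * mulCoef (2 * p.lam - m) j k *
      (coef (p.lamj j) n * n.descFactorial (k - j - 1) / coef (p.lamj k) (n - (k - j - 1)))) := by
  rw [entry, if_neg h.ne', if_pos h]

lemma entry_of_gt (h : k < j) (n : ℕ) : entry p k j n = 0 := by
  rw [entry, if_neg h.ne, if_neg h.not_gt]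

lemma entry_of_add_lt {n : ℕ} (h : n + 1 + j < k) : entry p k j n = 0 := by
  rw [entry_of_lt p (Fin.lt_def.2 (by lia)), Nat.descFactorial_of_lt (by lia)]
  simp

lemma exists_abs_entry_sub_le (k j : Fin (m + 1)) :
    ∃ C, 0 ≤ C ∧ ∀ n : ℕ, |entry p k j n - if k = j then 1 else 0| ≤ C / (n + 1) := by
  have hx : (0 : ℝ) < 2 * p.lamj j := mul_pos two_pos (p.lamj j).2
  suffices ∃ a, 0 ≤ a ∧ ∀ n : ℕ, |entry p k j n - if k = j then 1 else 0| ≤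
      a / (2 * p.lamj j + n) by
    obtain ⟨a, ha, hle⟩ := this
    refine ⟨a * (1 + 1 / (2 * p.lamj j)), by positivity, fun n => (hle n).trans ?_⟩
    rw [div_eq_mul_one_div, mul_div_assoc]
    exact mul_le_mul_of_nonneg_left (one_div_add_natCast_le hx n) ha
  rcases lt_trichotomy j k with hjk | rfl | hkj
  · refine ⟨|p.mu j / p.mu k * mulCoef (2 * p.lam - m) j k| *
      √(poch (2 * p.lamj j) (2 * (k - j - 1) + 2)), by positivity, fun n => ?_⟩
    have hpos := div_nonneg (mul_nonneg (coef_pos (p.lamj j).2 n).le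
      (n.descFactorial (k - j - 1)).cast_nonneg) (coef_pos (p.lamj k).2 (n - (k - j - 1))).le
    rw [entry_of_lt p hjk, if_neg hjk.ne', sub_zero, abs_neg, abs_mul, abs_of_nonneg hpos,
      mul_div_assoc |_|, lamj_eq_add p hjk]
    exact mul_le_mul_of_nonneg_left (coef_mul_descFactorial_div_coef_le (p.lamj j).2 _ n)
      (abs_nonneg _)
  · refine ⟨|1 - 2 * (p.lamj j : ℝ)|, abs_nonneg _, fun n => ?_⟩
    rw [entry_self, if_pos rfl]
    exact abs_coef_div_coef_succ_sub_one_le (p.lamj j).2 n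
  · exact ⟨0, le_rfl, fun n => by simp [entry_of_gt p hkj, hkj.ne]⟩

lemma isBigO_entry_sub_one (k j : Fin (m + 1)) :
    (fun n : ℕ => (entry p k j (n - j) : ℂ) - (1 : Matrix (Fin (m + 1)) (Fin (m + 1)) ℂ) k j)
      =O[atTop] fun n : ℕ => 1 / (n : ℝ) := by
  obtain ⟨C, hC, hle⟩ := exists_abs_entry_sub_le p k j
  refine .of_bound (C * (j + 1)) ?_
  filter_upwards [eventually_gt_atTop 0] with n hn
  have hreal : (entry p k j (n - j) : ℂ) - (1 : Matrix (Fin (m + 1)) (Fin (m + 1)) ℂ) k j =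
      ((entry p k j (n - j) - if k = j then 1 else 0 : ℝ) : ℂ) := by
    rw [Matrix.one_apply]
    split_ifs <;> simp
  have hindex : (n : ℝ) ≤ (j + 1) * ((n - j : ℕ) + 1) := by
    have h : n ≤ (j + 1) * (n - j + 1) := by
      nlinarith [Nat.zero_le ((j : ℕ) * (n - j)), show n ≤ n - j + j by lia]
    exact_mod_cast h
  have hn' : (0 : ℝ) < n := by exact_mod_cast hn
  rw [hreal, Complex.norm_real, Real.norm_eq_abs, norm_div, norm_one, RCLike.norm_natCast,
    mul_one_div]
  refine (hle (n - j)).trans ?_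
  rw [div_le_div_iff₀ (by positivity) hn', mul_assoc]
  exact mul_le_mul_of_nonneg_left hindex hC

lemma entry_smul_basis_apply_of_lt (h : j < k) (n : ℕ) (z : 𝔻) :
    (entry p k j n : ℂ) • basis p (k, n + 1 + j - k) z =
      -((p.mu j : ℂ) * coef (p.lamj j) n) •
        ((mulCoef (2 * p.lam - m) j k * n.descFactorial (k - j - 1) : ℝ) : ℂ) •
          Gam p k (monomial (p.lamj k) (n - (k - j - 1))) z := by
  rw [basis_apply, entry_of_lt p h]
  rcases lt_or_ge n (k - j - 1) with hn | hn
  · simp [Nat.descFactorial_of_lt hn]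
  have hcoef := coef_lamj_ne_zero p k (n - (k - j - 1))
  have hmu := mu_ne_zero p k
  have hindex : n + 1 + j - k = n - (k - j - 1) := by have := Fin.lt_def.1 h; lia
  rw [hindex, RKHS.coe_smul, Pi.smul_apply, e_apply]
  simp only [smul_smul]
  congr 1
  push_cast
  field_simp

lemma smul_basis_apply (j : Fin (m + 1)) (n : ℕ) (z : 𝔻) :
    (z : ℂ) • basis p (j, n) z =
      (∑ k : Fin (m + 1), (entry p k j n : ℂ) • basis p (k, n + 1 + j - k)) z := by
  have hdiag : (entry p j j n : ℂ) • basis p (j, n + 1 + j - j) z =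
      ((p.mu j : ℂ) * coef (p.lamj j) n) • Gam p j (monomial (p.lamj j) (n + 1)) z := by
    have hcoef := coef_lamj_ne_zero p j (n + 1)
    rw [Nat.add_sub_cancel, entry_self, basis_apply, RKHS.coe_smul, Pi.smul_apply, e_apply]
    simp only [smul_smul]
    congr 1
    push_cast
    field_simp
  rw [sum_vecSpace_apply, ← Finset.sum_subset (Finset.subset_univ (Finset.Ici j)),
    Finset.Ici_eq_cons_Ioi, Finset.sum_cons]
  · simp only [RKHS.coe_smul, Pi.smul_apply]
    rw [hdiag, Finset.sum_congr rfl fun k hk =>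
        entry_smul_basis_apply_of_lt p (Finset.mem_Ioi.1 hk) n z, ← Finset.smul_sum, neg_smul,
      ← sub_eq_add_neg, ← smul_sub, ← smul_Gam_monomial, basis_apply, RKHS.coe_smul,
      Pi.smul_apply, e_apply, smul_smul (p.mu j : ℂ), smul_comm]
  · intro k _ hk
    rw [entry_of_gt p (not_le.1 fun h => hk (Finset.mem_Ici.2 h)), Complex.ofReal_zero, zero_smul,
      RKHS.coe_zero, Pi.zero_apply]

end Entries

section Shift

lemma exists_blockUnilateralShift :
    ∃ U : VecSpace p →ₗᵢ[ℂ] VecSpace p, ∀ a, U (basis p a) = basis p (a.1, a.2 + 1) :=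
  exists_linearIsometry_of_orthonormal (basis p) <| (basis p).orthonormal.comp _ <|
    Function.injective_id.prodMap Nat.succ_injective

/-- The block unilateral shift `U_+`. -/
def blockUnilateralShift : VecSpace p →ₗᵢ[ℂ] VecSpace p := (exists_blockUnilateralShift p).choose

lemma blockUnilateralShift_basis (a : Fin (m + 1) × ℕ) :
    blockUnilateralShift p (basis p a) = basis p (a.1, a.2 + 1) :=
  (exists_blockUnilateralShift p).choose_spec a

lemma blockUnilateralShift_e (j : Fin (m + 1)) (n : ℕ) :
    blockUnilateralShift p (e p j n) = e p j (n + 1) := by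
  rw [e_eq_smul_basis, map_smul, blockUnilateralShift_basis, ← e_eq_smul_basis]

/-- The image of the basis vector at `a` under `M - U_+`. -/
def shiftDefect (a : Fin (m + 1) × ℕ) : VecSpace p :=
  ∑ k, ((entry p k a.1 a.2 - if k = a.1 then 1 else 0 : ℝ) : ℂ) • basis p (k, a.2 + 1 + a.1 - k)

lemma basis_add_shiftDefect (j : Fin (m + 1)) (n : ℕ) :
    basis p (j, n + 1) + shiftDefect p (j, n) =
      ∑ k, (entry p k j n : ℂ) • basis p (k, n + 1 + j - k) := by
  have hdiag : ∑ k, (((if k = j then 1 else 0 : ℝ)) : ℂ) • basis p (k, n + 1 + j - k) =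
      basis p (j, n + 1) := by
    rw [Finset.sum_eq_single j (fun k _ hk => by simp [hk]) (by simp)]
    simp
  simp only [shiftDefect, Complex.ofReal_sub, sub_smul, Finset.sum_sub_distrib, hdiag]
  abel

lemma summable_norm_shiftDefect_sq : Summable fun a => ‖shiftDefect p a‖ ^ 2 := by
  choose C _ hC using exists_abs_entry_sub_le p
  have hnorm : ∀ j n, ‖shiftDefect p (j, n)‖ ≤ (∑ k, C k j) / ((n : ℝ) + 1) := fun j n => by
    rw [Finset.sum_div]
    refine norm_sum_le_of_le _ fun k _ => ?_
    rw [norm_smul, (basis p).orthonormal.1, mul_one, Complex.norm_real, Real.norm_eq_abs]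
    exact hC k j n
  have hsum : Summable fun n : ℕ => 1 / ((n : ℝ) + 1) ^ 2 := by
    exact_mod_cast (summable_nat_add_iff 1).2 (Real.summable_one_div_nat_pow.2 one_lt_two)
  rw [summable_prod_of_nonneg fun a => sq_nonneg _]
  refine ⟨fun j => ?_, Summable.of_finite⟩
  refine .of_nonneg_of_le (fun n => sq_nonneg _) (fun n => ?_) (hsum.mul_left ((∑ k, C k j) ^ 2))
  rw [mul_one_div, ← div_pow]
  exact pow_le_pow_left₀ (norm_nonneg _) (hnorm j n) 2

end Shift

section MulZ

/-- The operator `M` of multiplication by the coordinate function, built as a perturbation of the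
block unilateral shift. -/
def mulZ : VecSpace p →L[ℂ] VecSpace p :=
  (blockUnilateralShift p).toContinuousLinearMap +
    ∑' a, InnerProductSpace.rankOne ℂ (shiftDefect p a) (basis p a)

lemma mulZ_sub_blockUnilateralShift_basis (a : Fin (m + 1) × ℕ) :
    (mulZ p - (blockUnilateralShift p).toContinuousLinearMap) (basis p a) = shiftDefect p a := by
  rw [mulZ, add_sub_cancel_left,
    tsum_rankOne_apply (basis p).orthonormal (summable_norm_shiftDefect_sq p)]

lemma isHilbertSchmidt_mulZ_sub :
    IsHilbertSchmidt (mulZ p - (blockUnilateralShift p).toContinuousLinearMap) :=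
  ⟨_, basis p, by
    simpa only [mulZ_sub_blockUnilateralShift_basis] using summable_norm_shiftDefect_sq p⟩

lemma mulZ_basis (j : Fin (m + 1)) (n : ℕ) :
    mulZ p (basis p (j, n)) = ∑ k, (entry p k j n : ℂ) • basis p (k, n + 1 + j - k) := by
  rw [← basis_add_shiftDefect, ← mulZ_sub_blockUnilateralShift_basis, sub_apply,
    LinearIsometry.coe_toContinuousLinearMap, blockUnilateralShift_basis]
  abel

theorem isMulOperator_mulZ : IsMulOperator (mulZ p) fun z : 𝔻 => (z : ℂ) :=
  isMulOperator_of_hilbertBasis (basis p) fun (j, n) z => by rw [mulZ_basis, smul_basis_apply]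

lemma mulZ_mu_e {n : ℕ} {j : Fin (m + 1)} (hj : (j : ℕ) ≤ n) :
    mulZ p ((p.mu j : ℂ) • e p j (n - j)) =
      ∑ k ∈ Finset.univ.filter (fun k : Fin (m + 1) => (k : ℕ) ≤ n + 1),
        (entry p k j (n - j) : ℂ) • (p.mu k : ℂ) • e p k (n + 1 - k) := by
  rw [← basis_apply, mulZ_basis, Finset.sum_filter]
  refine Finset.sum_congr rfl fun k _ => ?_
  split_ifs with hk
  · rw [basis_apply, show n - (j : ℕ) + 1 + j = n + 1 by lia]
  · rw [entry_of_add_lt p (by lia), Complex.ofReal_zero, zero_smul]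

theorem isBlockShift_mulZ : IsBlockShift (mulZ p) (blockSpace p) := by
  rw [blockSpace_eq_span_basis]
  refine ⟨isHilbertSum_span_image_preimage (basis p) _ fun n => ?_, fun n => ?_⟩
  · refine (Set.finite_univ.prod (Set.finite_Iic n)).subset fun a ha => ⟨Set.mem_univ _, ?_⟩
    exact Set.mem_Iic.2 ((Nat.le_add_right _ _).trans_eq ha)
  · change Submodule.span ℂ _ ≤
      Submodule.comap (mulZ p : VecSpace p →ₗ[ℂ] VecSpace p) (Submodule.span ℂ _)
    refine Submodule.span_le.2 ?_
    rintro _ ⟨⟨j, i⟩, rfl, rfl⟩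
    rw [SetLike.mem_coe, Submodule.mem_comap, ContinuousLinearMap.coe_coe, mulZ_basis]
    refine Submodule.sum_mem _ fun k _ => ?_
    rcases lt_or_ge (i + 1 + (j : ℕ)) k with hk | hk
    · rw [entry_of_add_lt p hk, Complex.ofReal_zero, zero_smul]
      exact Submodule.zero_mem _
    · refine Submodule.smul_mem _ _ (Submodule.subset_span ⟨_, ?_, rfl⟩)
      simp only [Set.mem_preimage, Set.mem_singleton_iff]
      lia

end MulZ

section CowenDouglas

lemma e_zero_apply (l : Fin (m + 1)) (z : 𝔻) : e p l 0 z = EuclideanSpace.single l (1 : ℂ) := by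
  ext i
  rw [e_apply, PiLp.smul_apply, Gam_monomial_apply]
  rcases lt_trichotomy i l with h | rfl | h
  · simp [gamCoef_of_lt _ (Fin.lt_def.1 h), h.ne]
  · simp [gamCoef, coef, poch_zero]
  · simp [Nat.descFactorial_of_lt (Nat.sub_pos_of_lt (Fin.lt_def.1 h)), h.ne']

/-- The constant functions, as an operator from `ℂ^(m+1)` to `A^(λ,μ)(𝔻)`. -/
def const : EuclideanSpace ℂ (Fin (m + 1)) →L[ℂ] VecSpace p :=
  LinearMap.toContinuousLinearMap
    ((EuclideanSpace.basisFun (Fin (m + 1)) ℂ).toBasis.constr ℂ fun l => e p l 0)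

lemma const_single (l : Fin (m + 1)) : const p (EuclideanSpace.single l 1) = e p l 0 := by
  have h := (EuclideanSpace.basisFun (Fin (m + 1)) ℂ).toBasis.constr_basis ℂ (fun l => e p l 0) l
  rwa [OrthonormalBasis.coe_toBasis, EuclideanSpace.basisFun_apply] at h

lemma const_apply (v : EuclideanSpace ℂ (Fin (m + 1))) (z : 𝔻) : const p v z = v := by
  have hsum : v = ∑ l, v l • EuclideanSpace.single l (1 : ℂ) := by
    simpa using ((EuclideanSpace.basisFun (Fin (m + 1)) ℂ).sum_repr v).symm
  conv_lhs => rw [hsum]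
  conv_rhs => rw [hsum]
  simp only [map_sum, map_smul, sum_vecSpace_apply, RKHS.coe_smul, Pi.smul_apply, const_single,
    e_zero_apply]

lemma e_eq_sum_pow {M : VecSpace p →L[ℂ] VecSpace p}
    (hM : IsMulOperator M fun z : 𝔻 => (z : ℂ)) (j : Fin (m + 1)) (n : ℕ) :
    e p j n = ∑ l : Fin (m + 1),
      ((coef (p.lamj j) n * gamCoef (2 * p.lam - m) j l * n.descFactorial (l - j) : ℝ) : ℂ) •
        (M ^ (n - (l - j) : ℕ)) (const p (EuclideanSpace.single l 1)) := by
  refine RKHS.ext fun z => ?_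
  ext i
  simp only [sum_vecSpace_apply, WithLp.ofLp_sum, Finset.sum_apply, RKHS.coe_smul, Pi.smul_apply,
    hM.pow _ _ z, Pi.pow_apply, const_apply, PiLp.smul_apply, smul_eq_mul]
  rw [Finset.sum_eq_single i (fun l _ hl => by simp [hl.symm]) (by simp), e_apply,
    PiLp.smul_apply, Gam_monomial_apply, PiLp.single_apply, if_pos rfl, smul_eq_mul]
  push_cast
  ring

lemma closure_span_pow_const {M : VecSpace p →L[ℂ] VecSpace p}
    (hM : IsMulOperator M fun z : 𝔻 => (z : ℂ)) :
    (Submodule.span ℂ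
      {F | ∃ (i : ℕ), ∃ G ∈ Set.range (const p), (M ^ i) G = F}).topologicalClosure = ⊤ := by
  rw [eq_top_iff, ← (basis p).dense_span]
  refine Submodule.topologicalClosure_mono (Submodule.span_le.2 ?_)
  rintro _ ⟨⟨j, n⟩, rfl⟩
  rw [basis_apply, e_eq_sum_pow p hM]
  exact Submodule.smul_mem _ _ (Submodule.sum_mem _ fun l _ =>
    Submodule.smul_mem _ _ (Submodule.subset_span ⟨_, _, ⟨_, rfl⟩, rfl⟩))

theorem isCowenDouglas_adjoint_mulZ :
    IsCowenDouglas (ContinuousLinearMap.adjoint (mulZ p)) (Metric.ball 0 1) (m + 1) := by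
  simpa only [finrank_euclideanSpace_fin] using
    (isMulOperator_mulZ p).isCowenDouglas_adjoint (continuous_vecSpace p)
      (isHilbertSchmidt_mulZ_sub p).isCompactOperator (const_apply p)
      (closure_span_pow_const p (isMulOperator_mulZ p))

end CowenDouglas

end HomogShift

end

theorem mainTheorem3 (m : ℕ) (hm : 0 < m) (p : HomogShift.Params m) :
    ∃ M U : HomogShift.VecSpace p →L[ℂ] HomogShift.VecSpace p,
      -- `M` is the operator of multiplication by the coordinate function
      (∀ (F : HomogShift.VecSpace p) (z : Complex.UnitDisc), M F z = (z : ℂ) • F z) ∧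
      -- `U` is the block unilateral shift
      (∀ (j : Fin (m + 1)) (n : ℕ), U (HomogShift.e p j n) = HomogShift.e p j (n + 1)) ∧
      HomogShift.IsBlockShift M (HomogShift.blockSpace p) ∧
      -- the blocks `B n` of `M` with respect to the orthonormal vectors `μ_j e_{n-j}^j`
      (∃ B : ℕ → Matrix (Fin (m + 1)) (Fin (m + 1)) ℂ,
        (∀ (n : ℕ) (j : Fin (m + 1)), (j : ℕ) ≤ n →
          M ((p.mu j : ℂ) • HomogShift.e p j (n - j)) =
            ∑ k ∈ Finset.univ.filter (fun k : Fin (m + 1) => (k : ℕ) ≤ n + 1),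
              B n k j • (p.mu k : ℂ) • HomogShift.e p k (n + 1 - k)) ∧
        ∀ k j : Fin (m + 1),
          (fun n : ℕ => B n k j - (1 : Matrix (Fin (m + 1)) (Fin (m + 1)) ℂ) k j)
            =O[Filter.atTop] fun n : ℕ => 1 / (n : ℝ)) ∧
      HomogShift.IsHilbertSchmidt (M - U) ∧
      HomogShift.IsCowenDouglas (ContinuousLinearMap.adjoint M) (Metric.ball 0 1) (m + 1) := by
  refine ⟨HomogShift.mulZ p, (HomogShift.blockUnilateralShift p).toContinuousLinearMap,
    HomogShift.isMulOperator_mulZ p, HomogShift.blockUnilateralShift_e p,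
    HomogShift.isBlockShift_mulZ p, ?_, HomogShift.isHilbertSchmidt_mulZ_sub p,
    HomogShift.isCowenDouglas_adjoint_mulZ p⟩
  exact ⟨fun n => .of fun k j => HomogShift.entry p k j (n - j),
    fun _ _ hj => HomogShift.mulZ_mu_e p hj, HomogShift.isBigO_entry_sub_one p⟩
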